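/- Let $X$ be the fibre over $(0,0)$ of the map $\mathrm{Hilb}^2(\mathbb C^2)\to\mathbb C^2$ (sum of the two points), a symplectic surface with an action of $H=\mathbb C^\times_a$, $(x,y)\mapsto(ax,a^{-1}y)$, and of $\mathbb S=\mathbb C^\times_v$, $(x,y)\mapsto(v^{-1}x,v^{-1}y)$, and let $K=\mathbb C^\times_z$. The fixed points $X^H$ are labelled by the partitions $[2],[1,1]$ of $2$. Let $F$ be the field of multi-valued meromorphic functions of $(a,z,v,q)\in H\times K\times\mathbb S\times\{0<|q|<1\}$, i.e. of meromorphic functions on the universal cover of this space; put $\bar f(a,z,v;q)=f(a,z,v^{-1};q)$ and $\mathbb E_{\mathrm{loc}}=F^{X^H}$, with elements written as column vectors whose entries are ordered as $[2],[1,1]$. Let $$\vartheta(x)=(x^{1/2}-x^{-1/2})\prod_{m\ge1}(1-q^mx)(1-q^mx^{-1}),\qquad (q;q)_\infty=\prod_{m\ge1}(1-q^m),$$ and for $n\in\tfrac12\mathbb Z$ let $\mathcal O(n)$ be the vector with $\mathcal O(n)|_{[2]}=(v^2a^{-1})^n$, $\mathcal O(n)|_{[1,1]}=(v^2a)^n$.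 The elliptic stable bases of $\mathfrak X$ (the surface $X$ with the chamber $\xi=1$) and of $-\mathfrak X$ (with $\xi=-1$) are $$\mathrm{Stab}_{\mathfrak X}([2])=\begin{pmatrix}\vartheta(a^{-2})\vartheta(v^{-2}z^{-2})\\0\end{pmatrix},\quad \mathrm{Stab}_{\mathfrak X}([1,1])=\begin{pmatrix}\frac{\vartheta(v^{-2})\left(\vartheta(a^{-2})\vartheta(vz^2a^{-1})\vartheta(v^{-1}z)+\vartheta(v^{-1}a^{-1})\vartheta(vza^{-2})\vartheta(z^{-2})\right)}{\vartheta(v^{-1}a)\vartheta(vz)}\\\vartheta(v^{-2}a^{-2})\vartheta(z^{-2})\end{pmatrix},$$ $$\mathrm{Stab}_{-\mathfrak X}([2])=\begin{pmatrix}\vartheta(v^{-2}a^{2})\vartheta(z^{-2})\\\frac{\vartheta(v^{-2})\left(\vartheta(a^{2})\vartheta(vz^2a)\vartheta(v^{-1}z)+\vartheta(v^{-1}a)\vartheta(vza^{2})\vartheta(z^{-2})\right)}{\vartheta(v^{-1}a^{-1})\vartheta(vz)}\end{pmatrix},\quad \mathrm{Stab}_{-\mathfrak X}([1,1])=\begin{pmatrix}0\\\vartheta(a^{2})\vartheta(v^{-2}z^{-2})\end{pmatrix}.$$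 Write $\mathrm{Stab}^{ell}_{-\mathfrak X}$ for the matrix with columns $\mathrm{Stab}_{-\mathfrak X}([2]),\mathrm{Stab}_{-\mathfrak X}([1,1])$. The elliptic bar involution $\beta^{ell}_{\mathfrak X}$ is the map $\mathbb E_{\mathrm{loc}}\to\mathbb E_{\mathrm{loc}}$, semilinear with respect to $f\mapsto\bar f$, with $\beta^{ell}_{\mathfrak X}(\mathrm{Stab}_{\mathfrak X}(p))=(-1)^{\dim X/2}\,\mathrm{Stab}_{-\mathfrak X}(p)=-\mathrm{Stab}_{-\mathfrak X}(p)$ for $p\in X^H$. Let $f_i(v;q)$, $i=0,1,2$, be (possibly multi-valued) holomorphic functions and $c_0,c_1,c_2\in\mathbb R$ with $c_2\ge c_1+\frac34$, such that $q^{-c_i}f_i(v;q)$ is single-valued in $v\in\mathbb C^\times$ and $q^{1/2}$, and, as $q\to0$, $$f_0=q^{c_0}(1+O(q^{1/2})),\qquad f_1=q^{c_1}(1+O(q^{1/2})),\qquad f_2=q^{c_2}\,O(1).$$ Put $$\mathcal E^{ell}_{\mathfrak X}([2])=f_1\sum_{l,m\in\mathbb Z}(-1)^mq^{l^2+\frac12(m+\frac12)^2}v^{-2l+2m+1}z^{2l+m+\frac12}\mathcal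 O(2l-m-\tfrac12)+f_2\sum_{l,m\in\mathbb Z}(-1)^mq^{(l+\frac12)^2+\frac12(m+\frac12)^2}v^{-2l+2m}z^{2l+m+\frac32}\mathcal O(2l-m+\tfrac12),$$ $$\mathcal E^{ell}_{\mathfrak X}([1,1])=f_0\sum_{m\in\mathbb Z}(-1)^mq^{\frac12(m+\frac12)^2}z^{m+\frac12}\mathcal O(m+\tfrac12),$$ $$\Upsilon(v;q)=q^{1/4}(q;q)_\infty^2\,f_0\Big(f_1\sum_{m\in\mathbb Z}q^{m^2}v^{2m}+f_2\sum_{m\in\mathbb Z}q^{(m+\frac12)^2}v^{2m+1}\Big).$$ Let $\mathcal E^{ell}_{\mathfrak X}$ be the matrix with columns $\mathcal E^{ell}_{\mathfrak X}([2]),\mathcal E^{ell}_{\mathfrak X}([1,1])$, and set $$\mathcal E^{ell}_{-\mathfrak X}=\mathcal E^{ell}_{\mathfrak X},\qquad \mathcal E^{ell}_{\mathfrak X^!}=\Omega\cdot\mathcal E^{ell}_{\mathfrak X}\big|_{a\leftrightarrow z}\cdot\Omega,\quad \Omega=\begin{pmatrix}0&1\\1&0\end{pmatrix},\qquad \mathcal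 E^{ell}_{\mathfrak X^!_{\mathrm{flop}}}=\overline{\mathcal E^{ell}_{\mathfrak X^!}}.$$ Assume in addition that $f_i(v^{-1};q)=f_i(v;q)$ for $i=0,1,2$. Then $$-\Upsilon(v;q)\cdot\mathrm{Stab}^{ell}_{-\mathfrak X}=\mathcal E^{ell}_{-\mathfrak X}\cdot{}^t\mathcal E^{ell}_{\mathfrak X^!_{\mathrm{flop}}}.$$ In particular, the elliptic bar involution $\beta^{ell}_{\mathfrak X}$ (which exists and is unique) satisfies $\beta^{ell}_{\mathfrak X}(\mathcal E^{ell}_{\mathfrak X}(\mu))=\mathcal E^{ell}_{\mathfrak X}(\mu)$ for $\mu=[2],[1,1]$. -/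

import Mathlib

open Complex Matrix Filter Topology

noncomputable section

namespace EllHilb

/-! ### Multi-valued holomorphic and meromorphic functions

The torus coordinates are `a = exp (2πiα)`, `z = exp (2πiζ)`, `v = exp (2πiν)`, `q = exp (2πiτ)`.
Multi-valued functions on `ℂˣ × ℂˣ × ℂˣ × {0 < |q| < 1}` are functions on its universal cover, the
space of all `(α, ζ, ν, τ)` with `0 < Im τ`. -/

/-- `e x = exp (2πix)`. -/
def e (x : ℂ) : ℂ := exp (2 * Real.pi * I * x)

/-- The universal cover of `H × K × 𝕊 × 𝔇°`, with coordinates `(α, ζ, ν, τ)`. -/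
def cover : Set (ℂ × ℂ × ℂ × ℂ) := {p | 0 < p.2.2.2.im}

/-- The ring of holomorphic functions on the universal cover, i.e. of multi-valued holomorphic
functions on `H × K × 𝕊 × 𝔇°`. -/
def Hol : Subring (cover → ℂ) where
  carrier := {f | ∃ g : ℂ × ℂ × ℂ × ℂ → ℂ, DifferentiableOn ℂ g cover ∧ ∀ p : cover, f p = g p}
  mul_mem' := by
    rintro f f' ⟨g, hg, h⟩ ⟨g', hg', h'⟩
    exact ⟨g * g', hg.mul hg', fun p => by simp [h, h']⟩
  one_mem' := ⟨1, differentiableOn_const 1, fun p => rfl⟩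
  add_mem' := by
    rintro f f' ⟨g, hg, h⟩ ⟨g', hg', h'⟩
    exact ⟨g + g', hg.add hg', fun p => by simp [h, h']⟩
  zero_mem' := ⟨0, differentiableOn_const 0, fun p => rfl⟩
  neg_mem' := by
    rintro f ⟨g, hg, h⟩
    exact ⟨-g, hg.neg, fun p => by simp [h]⟩

/-- If a product of two holomorphic functions on the (convex) cover vanishes and the first factor
is nonzero at `x`, then the second vanishes at every `y`: restrict to the line through `x`, `y`. -/
theorem line_eq_zero {g g' : ℂ × ℂ × ℂ × ℂ → ℂ} (hg : DifferentiableOn ℂ g cover)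
    (hg' : DifferentiableOn ℂ g' cover) (h : ∀ p ∈ cover, g p * g' p = 0)
    {x y : ℂ × ℂ × ℂ × ℂ} (hx : x ∈ cover) (hy : y ∈ cover) (hgx : g x ≠ 0) : g' y = 0 := by
  let L : ℂ → ℂ × ℂ × ℂ × ℂ := fun t => x + t • (y - x)
  have hL : Differentiable ℂ L := by fun_prop
  let S : Set ℂ := L ⁻¹' cover
  have hcov : IsOpen cover := isOpen_lt continuous_const (by fun_prop)
  have hS : IsOpen S := hcov.preimage hL.continuous
  have hconv : Convex ℝ S := by
    intro s hs t ht c d hc hd hcd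
    change 0 < (L (c • s + d • t)).2.2.2.im
    have hs' : 0 < (L s).2.2.2.im := hs
    have ht' : 0 < (L t).2.2.2.im := ht
    have : (L (c • s + d • t)).2.2.2.im = c * (L s).2.2.2.im + d * (L t).2.2.2.im := by
      obtain rfl : c = 1 - d := by linarith
      simp [L]
      ring
    rw [this]
    rcases hc.eq_or_lt with rfl | hc
    · have : d = 1 := by linarith
      subst this
      simpa using ht'
    · nlinarith [mul_pos hc hs', mul_nonneg hd ht'.le]
  have h0 : (0 : ℂ) ∈ S := by simpa [S, L] using hx
  have h1 : (1 : ℂ) ∈ S := by simpa [S, L] using hy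
  have ha : AnalyticOnNhd ℂ (g ∘ L) S :=
    (hg.comp hL.differentiableOn fun t ht => ht).analyticOnNhd hS
  have ha' : AnalyticOnNhd ℂ (g' ∘ L) S :=
    (hg'.comp hL.differentiableOn fun t ht => ht).analyticOnNhd hS
  have hne : ∀ᶠ t in 𝓝 (0 : ℂ), (g ∘ L) t ≠ 0 :=
    (ha 0 h0).continuousAt.eventually_ne (by simpa [L] using hgx)
  have hz : (g' ∘ L) =ᶠ[𝓝 0] 0 := by
    filter_upwards [hne, hS.mem_nhds h0] with t ht htS
    exact (mul_eq_zero.mp (h (L t) htS)).resolve_left ht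
  have := ha'.eqOn_zero_of_preconnected_of_eventuallyEq_zero hconv.isPreconnected h0 hz h1
  simpa [L] using this

instance : IsDomain Hol := by
  have : Nontrivial Hol :=
    ⟨0, 1, fun h => by
      have := congrArg (fun f : Hol => f.1 ⟨(0, 0, 0, I), by simp [cover]⟩) h
      simp at this⟩
  have : NoZeroDivisors Hol := ⟨by
    rintro ⟨f, g, hg, hf⟩ ⟨f', g', hg', hf'⟩ hm
    by_contra! hne
    obtain ⟨h1, h2⟩ := hne
    have : ∃ x : cover, f x ≠ 0 := by
      by_contra! hc
      exact h1 (Subtype.ext (funext hc))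
    obtain ⟨x, hx⟩ := this
    refine h2 (Subtype.ext (funext fun y => ?_))
    have hm' : ∀ p ∈ cover, g p * g' p = 0 := by
      intro p hp
      have := congrArg (fun k : Hol => k.1 ⟨p, hp⟩) hm
      simpa [hf, hf'] using this
    rw [hf] at hx
    change f' y = 0
    rw [hf']
    exact line_eq_zero hg hg' hm' x.2 y.2 hx⟩
  exact NoZeroDivisors.to_isDomain Hol

/-- The field of multi-valued meromorphic functions on `H × K × 𝕊 × 𝔇°`: meromorphic functions on
the universal cover. The cover is a contractible domain of holomorphy, so that these are the
quotients of holomorphic functions. -/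
abbrev F : Type := FractionRing Hol

/-- The element of `F` given by a holomorphic function of `(α, ζ, ν, τ)`. -/
def toF (g : ℂ → ℂ → ℂ → ℂ → ℂ)
    (hg : DifferentiableOn ℂ (fun p : ℂ × ℂ × ℂ × ℂ => g p.1 p.2.1 p.2.2.1 p.2.2.2) cover) : F :=
  algebraMap Hol F ⟨fun p => g p.1.1 p.1.2.1 p.1.2.2.1 p.1.2.2.2, _, hg, fun _ => rfl⟩

/-- Pull-back of holomorphic functions along a holomorphic map of the cover to itself. -/
def pull (φ : ℂ × ℂ × ℂ × ℂ → ℂ × ℂ × ℂ × ℂ) (hφ : Differentiable ℂ φ)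
    (hτ : ∀ p, (φ p).2.2.2 = p.2.2.2) : Hol →+* Hol where
  toFun f := ⟨fun p => f.1 ⟨φ p, by have := p.2; simpa [cover, hτ] using this⟩, by
    obtain ⟨f, g, hg, hf⟩ := f
    refine ⟨g ∘ φ, hg.comp hφ.differentiableOn fun p hp => ?_, fun p => hf _⟩
    simpa [cover, hτ] using hp⟩
  map_one' := rfl
  map_mul' _ _ := rfl
  map_zero' := rfl
  map_add' _ _ := rfl

/-- The automorphism `f ↦ f ∘ φ` of `F`, for a holomorphic involution `φ` of the cover. -/
def substF (φ : ℂ × ℂ × ℂ × ℂ → ℂ × ℂ × ℂ × ℂ) (hφ : Differentiable ℂ φ)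
    (hτ : ∀ p, (φ p).2.2.2 = p.2.2.2) (hinv : ∀ p, φ (φ p) = p) : F ≃+* F :=
  IsFractionRing.ringEquivOfRingEquiv
    (RingEquiv.ofRingHom (pull φ hφ hτ) (pull φ hφ hτ)
      (by ext f; simp [pull, hinv]) (by ext f; simp [pull, hinv]))

/-- The bar involution `f(a, z, v; q) ↦ f(a, z, v⁻¹; q)` of `F`. -/
def bar : F ≃+* F :=
  substF (fun p => (p.1, p.2.1, -p.2.2.1, p.2.2.2)) (by fun_prop) (fun _ => rfl) (fun _ => by simp)

/-- The exchange `a ↔ z` on `F`. -/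
def swap : F ≃+* F :=
  substF (fun p => (p.2.1, p.1, p.2.2.1, p.2.2.2)) (by fun_prop) (fun _ => rfl) (fun _ => rfl)

/-! ### Theta function -/

/-- `ϑ(x; q) = (x^{1/2} - x^{-1/2}) ∏_{m ≥ 1} (1 - q^m x)(1 - q^m x⁻¹)` at `x = e u`,
`q = e τ`. -/
def thetaFun (u τ : ℂ) : ℂ :=
  (e (u / 2) - e (-(u / 2))) *
    ∏' m : ℕ, ((1 - e ((m + 1) * τ + u)) * (1 - e ((m + 1) * τ - u)))

theorem norm_e (x : ℂ) : ‖e x‖ = Real.exp (-(2 * Real.pi * x.im)) := by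
  rw [e, Complex.norm_exp]
  congr 1
  simp [mul_assoc]

theorem e_add (x y : ℂ) : e (x + y) = e x * e y := by
  rw [e, e, e, ← Complex.exp_add]; congr 1; ring

theorem differentiable_e : Differentiable ℂ e := by
  unfold e; fun_prop

/-- A uniform limit of holomorphic functions of several variables is holomorphic. -/
theorem differentiableAt_of_tendstoUniformlyOn {E : Type*} [NormedAddCommGroup E]
    [NormedSpace ℂ E] {G : ℕ → E → ℂ} {f : E → ℂ} {x : E} {r : ℝ} (hr : 0 < r)
    (hG : ∀ n, DifferentiableOn ℂ (G n) (Metric.ball x r))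
    (h : TendstoUniformlyOn G f atTop (Metric.ball x r)) : DifferentiableAt ℂ f x := by
  have hdiff : ∀ n, ∀ y ∈ Metric.ball x r, DifferentiableAt ℂ (G n) y := fun n y hy =>
    (hG n y hy).differentiableAt (Metric.isOpen_ball.mem_nhds hy)
  have key : ∀ m n : ℕ, ∀ ε > 0, (∀ y ∈ Metric.ball x r, ‖G m y - G n y‖ ≤ ε) →
      ∀ y ∈ Metric.ball x (r / 2), ‖fderiv ℂ (G m) y - fderiv ℂ (G n) y‖ ≤ ε * (4 / r) := by
    intro m n ε hε hmn y hy
    have hball : Metric.ball x (r / 2) ⊆ Metric.ball x r := Metric.ball_subset_ball (by linarith)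
    refine ContinuousLinearMap.opNorm_le_bound _ (by positivity) fun w => ?_
    rcases eq_or_ne w 0 with rfl | hw
    · simp
    have hw' : 0 < ‖w‖ := norm_pos_iff.mpr hw
    have hρ : 0 < r / 4 / ‖w‖ := by positivity
    have hin : ∀ t : ℂ, ‖t‖ ≤ r / 4 / ‖w‖ → y + t • w ∈ Metric.ball x r := by
      intro t ht
      have h1 : ‖t‖ * ‖w‖ ≤ r / 4 := by rwa [le_div_iff₀ hw'] at ht
      rw [Metric.mem_ball, dist_eq_norm] at hy ⊢
      calc ‖y + t • w - x‖ = ‖(y - x) + t • w‖ := by congr 1; abel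
        _ ≤ ‖y - x‖ + ‖t • w‖ := norm_add_le _ _
        _ < r := by rw [norm_smul]; linarith
    let g : ℂ → ℂ := fun t => G m (y + t • w) - G n (y + t • w)
    have hgd : ∀ t : ℂ, ‖t‖ ≤ r / 4 / ‖w‖ → HasDerivAt g
        (fderiv ℂ (G m) (y + t • w) w - fderiv ℂ (G n) (y + t • w) w) t := by
      intro t ht
      have hl : HasDerivAt (fun t : ℂ => y + t • w) w t := by
        simpa using ((hasDerivAt_id t).smul_const w).const_add y
      exact ((hdiff m _ (hin t ht)).hasFDerivAt.comp_hasDerivAt t hl).sub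
        ((hdiff n _ (hin t ht)).hasFDerivAt.comp_hasDerivAt t hl)
    have hdc : DiffContOnCl ℂ g (Metric.ball 0 (r / 4 / ‖w‖)) := by
      apply DifferentiableOn.diffContOnCl
      rw [closure_ball _ hρ.ne']
      intro t ht
      exact (hgd t (by simpa using ht)).differentiableAt.differentiableWithinAt
    have hb := Complex.norm_deriv_le_of_forall_mem_sphere_norm_le hρ hdc (C := ε)
      (fun t ht => hmn _ (hin t (by simpa using (mem_sphere_iff_norm.mp ht).le)))
    rw [(hgd 0 (by simpa using hρ.le)).deriv] at hb
    simp only [zero_smul, add_zero] at hb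
    refine hb.trans (le_of_eq ?_)
    field_simp
  have hU := Metric.uniformCauchySeqOn_iff.mp h.uniformCauchySeqOn
  have hC : UniformCauchySeqOn (fun n => fderiv ℂ (G n)) atTop (Metric.ball x (r / 2)) := by
    rw [Metric.uniformCauchySeqOn_iff]
    intro ε hε
    obtain ⟨N, hN⟩ := hU (ε * (r / 4) / 2) (by positivity)
    refine ⟨N, fun m hm n hn y hy => ?_⟩
    have := key m n (ε * (r / 4) / 2) (by positivity)
      (fun y hy => by rw [← dist_eq_norm]; exact (hN m hm n hn y hy).le) y hy
    rw [dist_eq_norm]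
    refine this.trans_lt ?_
    field_simp
    linarith
  have hlim : ∀ y ∈ Metric.ball x (r / 2), ∃ l, Tendsto (fun n => fderiv ℂ (G n) y) atTop (𝓝 l) :=
    fun y hy => cauchySeq_tendsto_of_complete (hC.cauchySeq hy)
  choose! g' hg' using hlim
  have hx : x ∈ Metric.ball x (r / 2) := Metric.mem_ball_self (by positivity)
  have hsub : Metric.ball x (r / 2) ⊆ Metric.ball x r := Metric.ball_subset_ball (by linarith)
  exact (hasFDerivAt_of_tendstoUniformlyOn Metric.isOpen_ball
    (hC.tendstoUniformlyOn_of_tendsto hg')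
    (fun n y hy => (hdiff n y (hsub hy)).hasFDerivAt)
    (fun y hy => h.tendsto_at (hsub hy)) hx).differentiableAt

theorem differentiableAt_thetaProd (u₀ τ₀ : ℂ) (hτ : 0 < τ₀.im) :
    DifferentiableAt ℂ (fun p : ℂ × ℂ => ∏' m : ℕ,
      ((1 - e ((m + 1) * p.2 + p.1)) * (1 - e ((m + 1) * p.2 - p.1)))) (u₀, τ₀) := by
  set r : ℝ := τ₀.im / 2 with hr_def
  have hr : 0 < r := by positivity
  let h : ℕ → ℂ × ℂ → ℂ := fun m p =>
    (1 - e ((m + 1) * p.2 + p.1)) * (1 - e ((m + 1) * p.2 - p.1)) - 1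
  have hh : ∀ m, Differentiable ℂ (h m) := by
    intro m
    have := differentiable_e
    fun_prop
  set ρ : ℝ := Real.exp (-(2 * Real.pi * r))
  have hρ1 : ρ < 1 := by
    rw [Real.exp_lt_one_iff]
    have := Real.pi_pos
    nlinarith [mul_pos this hr]
  have hρ0 : 0 < ρ := Real.exp_pos _
  set M : ℝ := Real.exp (2 * Real.pi * (|u₀.im| + r))
  have hM : 0 < M := Real.exp_pos _
  have hterm : ∀ m : ℕ, ∀ p ∈ Metric.closedBall (u₀, τ₀) r, ∀ w : ℂ, |w.im| ≤ |p.1.im| →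
      ‖e ((m + 1) * p.2 + w)‖ ≤ M * ρ ^ (m + 1) := by
    intro m p hp w hw
    rw [Metric.mem_closedBall, Prod.dist_eq, max_le_iff, dist_eq_norm, dist_eq_norm] at hp
    have h1 : |p.1.im - u₀.im| ≤ r := by
      simpa using (Complex.abs_im_le_norm (p.1 - u₀)).trans hp.1
    have h2 : |p.2.im - τ₀.im| ≤ r := by
      simpa using (Complex.abs_im_le_norm (p.2 - τ₀)).trans hp.2
    have h3 : r ≤ p.2.im := by
      have := (abs_le.mp h2).1
      linarith
    have h4 : |p.1.im| ≤ |u₀.im| + r := by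
      have := abs_add_le (p.1.im - u₀.im) u₀.im
      simp only [sub_add_cancel] at this
      linarith
    have h5 : -(|u₀.im| + r) ≤ w.im := by
      have := (abs_le.mp (hw.trans h4)).1
      linarith
    rw [norm_e, ← Real.exp_nat_mul, ← Real.exp_add]
    apply Real.exp_le_exp.mpr
    have him : ((m + 1 : ℂ) * p.2 + w).im = (m + 1) * p.2.im + w.im := by simp
    rw [him]
    push_cast
    have hπ := Real.pi_pos
    have hm : (0 : ℝ) ≤ m + 1 := by positivity
    nlinarith [mul_le_mul_of_nonneg_left (mul_le_mul_of_nonneg_left h3 hm) hπ.le,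
      mul_le_mul_of_nonneg_left h5 hπ.le]
  have hbound : ∀ m : ℕ, ∀ p ∈ Metric.closedBall (u₀, τ₀) r,
      ‖h m p‖ ≤ (2 * M + M * M) * ρ ^ (m + 1) := by
    intro m p hp
    have hA := hterm m p hp p.1 le_rfl
    have hB := hterm m p hp (-p.1) (by simp)
    rw [← sub_eq_add_neg] at hB
    set A := e ((m + 1) * p.2 + p.1)
    set B := e ((m + 1) * p.2 - p.1)
    have hpow : ρ ^ (m + 1) ≤ 1 := pow_le_one₀ hρ0.le hρ1.le
    have hpow0 : 0 < ρ ^ (m + 1) := by positivity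
    have heq : h m p = -A - B + A * B := by simp only [h, A, B]; ring
    rw [heq]
    calc ‖-A - B + A * B‖ ≤ ‖A‖ + ‖B‖ + ‖A‖ * ‖B‖ := by
          refine (norm_add_le _ _).trans ?_
          rw [norm_mul]
          gcongr
          simpa using norm_sub_le (-A) B
      _ ≤ M * ρ ^ (m + 1) + M * ρ ^ (m + 1) + (M * ρ ^ (m + 1)) * (M * 1) := by
          gcongr
          exact hB.trans (by gcongr)
      _ = (2 * M + M * M) * ρ ^ (m + 1) := by ring
  have hsum : Summable fun m : ℕ => (2 * M + M * M) * ρ ^ (m + 1) :=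
    ((summable_nat_add_iff 1).mpr (summable_geometric_of_lt_one hρ0.le hρ1)).mul_left _
  have hprod := (hsum.hasProdUniformlyOn_nat_one_add (isCompact_closedBall (u₀, τ₀) r)
    (Eventually.of_forall hbound) (fun m => (hh m).continuous.continuousOn)).tendstoUniformlyOn
  have hseq : TendstoUniformlyOn (fun (n : ℕ) p => ∏ i ∈ Finset.range n, (1 + h i p))
      (fun p => ∏' i, (1 + h i p)) atTop (Metric.ball (u₀, τ₀) r) := by
    intro s hs
    exact (tendsto_finset_range.eventually (hprod s hs)).mono
      fun n hn p hp => hn p (Metric.ball_subset_closedBall hp)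
  have hfin : ∀ n : ℕ, Differentiable ℂ fun p => ∏ i ∈ Finset.range n, (1 + h i p) := by
    intro n
    induction n with
    | zero => simp
    | succ n ih =>
      simp only [Finset.prod_range_succ]
      exact ih.mul ((hh n).const_add 1)
  have := differentiableAt_of_tendstoUniformlyOn hr (fun n => (hfin n).differentiableOn) hseq
  simpa [h] using this

theorem differentiableAt_thetaFun (u₀ τ₀ : ℂ) (hτ : 0 < τ₀.im) :
    DifferentiableAt ℂ (fun p : ℂ × ℂ => thetaFun p.1 p.2) (u₀, τ₀) := by
  have h1 := differentiable_e
  exact DifferentiableAt.mul (by fun_prop) (differentiableAt_thetaProd u₀ τ₀ hτ)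

/-- `ϑ(a^i z^j v^k)` as an element of `F`. -/
def theta (i j k : ℤ) : F :=
  toF (fun α ζ ν τ => thetaFun (i * α + j * ζ + k * ν) τ) fun p hp =>
    ((differentiableAt_thetaFun (i * p.1 + j * p.2.1 + k * p.2.2.1) p.2.2.2 hp).comp p
      (f := fun p : ℂ × ℂ × ℂ × ℂ => (i * p.1 + j * p.2.1 + k * p.2.2.1, p.2.2.2))
      (by fun_prop)).differentiableWithinAt

/-! ### Fixed points and elliptic stable bases -/

/-- The partitions `[2]` and `[1,1]` of `2`: the torus fixed points of `X`, which also label the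
elliptic canonical basis. -/
inductive FixedPoint
  | two
  | oneOne
  deriving DecidableEq

instance : Fintype FixedPoint := ⟨{.two, .oneOne}, fun p => by cases p <;> simp⟩

namespace FixedPoint

/-- `[2]! = [1,1]` and `[1,1]! = [2]`. -/
def dual : FixedPoint → FixedPoint
  | two => oneOne
  | oneOne => two

/-- `ε_{[2]} = 1` and `ε_{[1,1]} = -1`. -/
def sgn : FixedPoint → ℤ
  | two => 1
  | oneOne => -1

end FixedPoint

open FixedPoint

/-- The complex dimension of `X`, the fibre over `(0,0)` of `Hilb²(ℂ²) → ℂ²`. -/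
def dimX : ℕ := 2

/-- The localized space `E(X)_loc = ⊕_{p ∈ X^H} F`. -/
abbrev Loc : Type := FixedPoint → F

/-- `stabX p p' = Stab^ell_X(p)|_{p'}`. -/
def stabX : FixedPoint → Loc
  | two, two => theta (-2) 0 0 * theta 0 (-2) (-2)
  | two, oneOne => 0
  | oneOne, two =>
      theta 0 0 (-2) *
        (theta (-2) 0 0 * theta (-1) 2 1 * theta 0 1 (-1) +
          theta (-1) 0 (-1) * theta (-2) 1 1 * theta 0 (-2) 0) /
        (theta 1 0 (-1) * theta 0 1 1)
  | oneOne, oneOne => theta (-2) 0 (-2) * theta 0 (-2) 0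

/-- `stabNegX p p' = Stab^ell_{-X}(p)|_{p'}`. -/
def stabNegX : FixedPoint → Loc
  | two, two => theta 2 0 (-2) * theta 0 (-2) 0
  | two, oneOne =>
      theta 0 0 (-2) *
        (theta 2 0 0 * theta 1 2 1 * theta 0 1 (-1) +
          theta 1 0 (-1) * theta 2 1 1 * theta 0 (-2) 0) /
        (theta (-1) 0 (-1) * theta 0 1 1)
  | oneOne, two => 0
  | oneOne, oneOne => theta 2 0 0 * theta 0 (-2) (-2)

/-- The matrix `Stab^ell_{-X}`, whose columns are the vectors `Stab^ell_{-X}(p)`. -/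
def StabNegX : Matrix FixedPoint FixedPoint F := Matrix.of fun p' p => stabNegX p p'

/-- `β` is the elliptic bar involution of `X`: the semilinear map, with respect to
`f(a, z, v; q) ↦ f(a, z, v⁻¹; q)`, with `β(Stab_X(p)) = (-1)^{dim X / 2} Stab_{-X}(p)`. -/
def IsEllipticBarInvolution (β : Loc →ₛₗ[(bar : F →+* F)] Loc) : Prop :=
  ∀ p, β (stabX p) = (-1 : F) ^ (dimX / 2) • stabNegX p

/-! ### The parameters `f₀, f₁, f₂` -/

/-- Multi-valued holomorphic functions of `(v; q)`, as functions of `(ν, τ)` with `0 < Im τ`. -/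
structure ParamFun where
  /-- the function of `(ν, τ)`; only its values for `0 < Im τ` matter -/
  toFun : ℂ → ℂ → ℂ
  holo : DifferentiableOn ℂ (fun p : ℂ × ℂ => toFun p.1 p.2) {p | 0 < p.2.im}

instance : CoeFun ParamFun fun _ => ℂ → ℂ → ℂ := ⟨ParamFun.toFun⟩

/-- `q^{-c} f(v; q)` as a function of `(ν, τ)`. -/
def ParamFun.normalized (f : ParamFun) (c : ℝ) (ν τ : ℂ) : ℂ := e (-(c * τ)) * f ν τ

/-- `q^{-c} f(v; q)` is single-valued in `v` and `q^{1/2}`, i.e. on the product of `𝕊` with the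
double cover of the punctured disk. -/
def ParamFun.SingleValued (f : ParamFun) (c : ℝ) : Prop :=
  ∀ ν τ : ℂ, 0 < τ.im →
    f.normalized c (ν + 1) τ = f.normalized c ν τ ∧ f.normalized c ν (τ + 2) = f.normalized c ν τ

/-- The limit `q → 0`, i.e. `Im τ → ∞`. -/
def qToZero : Filter ℂ := Filter.comap Complex.im Filter.atTop

/-- The conditions on `f₀, f₁, f₂` with leading exponents `c₀, c₁, c₂`. -/
structure IsAdmissible (f₀ f₁ f₂ : ParamFun) (c₀ c₁ c₂ : ℝ) : Prop where
  single₀ : f₀.SingleValued c₀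
  single₁ : f₁.SingleValued c₁
  single₂ : f₂.SingleValued c₂
  /-- `f₀ = q^{c₀} (1 + O(q^{1/2}))` -/
  lead₀ : ∀ ν : ℂ, (fun τ => f₀.normalized c₀ ν τ - 1) =O[qToZero] fun τ => e (τ / 2)
  /-- `f₁ = q^{c₁} (1 + O(q^{1/2}))` -/
  lead₁ : ∀ ν : ℂ, (fun τ => f₁.normalized c₁ ν τ - 1) =O[qToZero] fun τ => e (τ / 2)
  /-- `f₂ = q^{c₂} O(1)` -/
  lead₂ : ∀ ν : ℂ, (fun τ => f₂.normalized c₂ ν τ) =O[qToZero] fun _ => (1 : ℂ)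
  le : c₁ + 3 / 4 ≤ c₂

/-- `f(v⁻¹; q) = f(v; q)`. -/
def ParamFun.BarInvariant (f : ParamFun) : Prop := ∀ ν τ : ℂ, 0 < τ.im → f (-ν) τ = f ν τ

/-! ### The elliptic canonical basis -/

/-- `𝒪(n)|_p`, that is `(v² a⁻¹)^n` at `[2]` and `(v² a)^n` at `[1,1]`, for `n ∈ ½ℤ`. -/
def lineBundle (p : FixedPoint) (n α ν : ℂ) : ℂ := e (n * (2 * ν - p.sgn * α))

/-- `∑_m (-1)^m q^{(m+1/2)²/2} z^{m+1/2} 𝒪(m+1/2)|_p`. -/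
def series₀ (p : FixedPoint) (α ζ ν τ : ℂ) : ℂ :=
  ∑' m : ℤ, (-1) ^ m * e ((m + 1 / 2) ^ 2 / 2 * τ) * e ((m + 1 / 2) * ζ) *
    lineBundle p (m + 1 / 2) α ν

/-- `∑_{l,m} (-1)^m q^{l²+(m+1/2)²/2} v^{-2l+2m+1} z^{2l+m+1/2} 𝒪(2l-m-1/2)|_p`. -/
def series₁ (p : FixedPoint) (α ζ ν τ : ℂ) : ℂ :=
  ∑' lm : ℤ × ℤ, (-1) ^ lm.2 * e ((lm.1 ^ 2 + (lm.2 + 1 / 2) ^ 2 / 2) * τ) *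
    e ((-2 * lm.1 + 2 * lm.2 + 1) * ν) * e ((2 * lm.1 + lm.2 + 1 / 2) * ζ) *
    lineBundle p (2 * lm.1 - lm.2 - 1 / 2) α ν

/-- `∑_{l,m} (-1)^m q^{(l+1/2)²+(m+1/2)²/2} v^{-2l+2m} z^{2l+m+3/2} 𝒪(2l-m+1/2)|_p`. -/
def series₂ (p : FixedPoint) (α ζ ν τ : ℂ) : ℂ :=
  ∑' lm : ℤ × ℤ, (-1) ^ lm.2 * e (((lm.1 + 1 / 2) ^ 2 + (lm.2 + 1 / 2) ^ 2 / 2) * τ) *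
    e ((-2 * lm.1 + 2 * lm.2) * ν) * e ((2 * lm.1 + lm.2 + 3 / 2) * ζ) *
    lineBundle p (2 * lm.1 - lm.2 + 1 / 2) α ν

theorem e_int (n : ℤ) : e n = 1 := by
  rw [e, Complex.exp_eq_one_iff]; exact ⟨n, by ring⟩

theorem e_half : e (1 / 2) = -1 := by
  rw [e, ← Complex.exp_pi_mul_I]; congr 1; ring

theorem e_zpow (x : ℂ) (n : ℤ) : e x ^ n = e (n * x) := by
  rw [e, e, ← Complex.exp_int_mul]; congr 1; ring

theorem jterm (n : ℤ) (w τ : ℂ) : jacobiTheta₂_term n w τ = e (n * w + n ^ 2 / 2 * τ) := by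
  rw [jacobiTheta₂_term, e]; congr 1; ring

theorem neg_one_zpow_eq (m : ℤ) : (-1 : ℂ) ^ m = e (m * (1 / 2)) := by
  rw [← e_half, e_zpow]

theorem summable_norm_jterm (w : ℂ) {τ : ℂ} (hτ : 0 < τ.im) :
    Summable fun n : ℤ => ‖jacobiTheta₂_term n w τ‖ :=
  ((summable_jacobiTheta₂_term_iff w τ).mpr hτ).norm

theorem series₀_eq (p : FixedPoint) (α ζ ν τ : ℂ) :
    series₀ p α ζ ν τ = e (τ / 8 + (ζ + (2 * ν - p.sgn * α)) / 2) *
      jacobiTheta₂ (ζ + (2 * ν - p.sgn * α) + τ / 2 + 1 / 2) τ := by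
  rw [series₀, jacobiTheta₂, ← tsum_mul_left]
  refine tsum_congr fun m => ?_
  rw [jterm, lineBundle, neg_one_zpow_eq, ← e_add, ← e_add, ← e_add, ← e_add]
  congr 1
  ring

theorem series₁_eq (p : FixedPoint) (α ζ ν : ℂ) {τ : ℂ} (hτ : 0 < τ.im) :
    series₁ p α ζ ν τ = e (τ / 8 + (ζ + p.sgn * α) / 2) *
      (jacobiTheta₂ (2 * (ζ + ν - p.sgn * α)) (2 * τ) *
        jacobiTheta₂ (ζ + p.sgn * α + τ / 2 + 1 / 2) τ) := by
  have h2 : 0 < (2 * τ).im := by simpa using hτ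
  rw [jacobiTheta₂, jacobiTheta₂, tsum_mul_tsum_of_summable_norm (summable_norm_jterm _ h2)
    (summable_norm_jterm _ hτ), ← tsum_mul_left, series₁]
  refine tsum_congr fun lm => ?_
  rw [jterm, jterm, lineBundle, neg_one_zpow_eq, ← e_add, ← e_add, ← e_add, ← e_add, ← e_add,
    ← e_add]
  congr 1
  ring

theorem series₂_eq (p : FixedPoint) (α ζ ν : ℂ) {τ : ℂ} (hτ : 0 < τ.im) :
    series₂ p α ζ ν τ = e (3 * τ / 8 + (ζ + ν - p.sgn * α) + (ζ + p.sgn * α) / 2) *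
      (jacobiTheta₂ (2 * (ζ + ν - p.sgn * α) + τ) (2 * τ) *
        jacobiTheta₂ (ζ + p.sgn * α + τ / 2 + 1 / 2) τ) := by
  have h2 : 0 < (2 * τ).im := by simpa using hτ
  rw [jacobiTheta₂, jacobiTheta₂, tsum_mul_tsum_of_summable_norm (summable_norm_jterm _ h2)
    (summable_norm_jterm _ hτ), ← tsum_mul_left, series₂]
  refine tsum_congr fun lm => ?_
  rw [jterm, jterm, lineBundle, neg_one_zpow_eq, ← e_add, ← e_add, ← e_add, ← e_add, ← e_add,
    ← e_add]
  congr 1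
  ring

theorem differentiableOn_jacobi {A B : ℂ × ℂ × ℂ × ℂ → ℂ} (hA : Differentiable ℂ A)
    (hB : Differentiable ℂ B) (him : ∀ p ∈ cover, 0 < (B p).im) :
    DifferentiableOn ℂ (fun p => jacobiTheta₂ (A p) (B p)) cover := fun p hp =>
  ((hasFDerivAt_jacobiTheta₂ (A p) (him p hp)).differentiableAt.comp p
    (f := fun p => (A p, B p)) (hA.prodMk hB).differentiableAt).differentiableWithinAt

theorem im_two_mul {p : ℂ × ℂ × ℂ × ℂ} (hp : p ∈ cover) : 0 < (2 * p.2.2.2).im := by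
  have : 0 < p.2.2.2.im := hp
  simpa using this

theorem differentiableOn_series₀ (p : FixedPoint) : DifferentiableOn ℂ
    (fun x : ℂ × ℂ × ℂ × ℂ => series₀ p x.1 x.2.1 x.2.2.1 x.2.2.2) cover := by
  simp only [series₀_eq]
  have h1 := differentiable_e
  exact DifferentiableOn.mul (Differentiable.differentiableOn (by fun_prop))
    (differentiableOn_jacobi (by fun_prop) (by fun_prop) fun x hx => hx)

theorem differentiableOn_series₁ (p : FixedPoint) : DifferentiableOn ℂ
    (fun x : ℂ × ℂ × ℂ × ℂ => series₁ p x.1 x.2.1 x.2.2.1 x.2.2.2) cover := by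
  have h1 := differentiable_e
  refine DifferentiableOn.congr ?_ fun x hx => series₁_eq p x.1 x.2.1 x.2.2.1 hx
  exact DifferentiableOn.mul (Differentiable.differentiableOn (by fun_prop))
    ((differentiableOn_jacobi (by fun_prop) (by fun_prop) fun x hx => im_two_mul hx).mul
      (differentiableOn_jacobi (by fun_prop) (by fun_prop) fun x hx => hx))

theorem differentiableOn_series₂ (p : FixedPoint) : DifferentiableOn ℂ
    (fun x : ℂ × ℂ × ℂ × ℂ => series₂ p x.1 x.2.1 x.2.2.1 x.2.2.2) cover := by
  have h1 := differentiable_e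
  refine DifferentiableOn.congr ?_ fun x hx => series₂_eq p x.1 x.2.1 x.2.2.1 hx
  exact DifferentiableOn.mul (Differentiable.differentiableOn (by fun_prop))
    ((differentiableOn_jacobi (by fun_prop) (by fun_prop) fun x hx => im_two_mul hx).mul
      (differentiableOn_jacobi (by fun_prop) (by fun_prop) fun x hx => hx))

theorem ParamFun.differentiableOn (f : ParamFun) : DifferentiableOn ℂ
    (fun x : ℂ × ℂ × ℂ × ℂ => f x.2.2.1 x.2.2.2) cover :=
  f.holo.comp (f := fun x : ℂ × ℂ × ℂ × ℂ => (x.2.2.1, x.2.2.2)) (by fun_prop) fun _ hx => hx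

/-- `f(v; q)` as an element of `F`. -/
def ParamFun.inF (f : ParamFun) : F := toF (fun _ _ ν τ => f ν τ) f.differentiableOn

/-- `canX f₀ f₁ f₂ μ p = E^ell_X(μ)|_p`, the elliptic canonical basis with parameters
`f₀, f₁, f₂`. -/
def canX (f₀ f₁ f₂ : ParamFun) : FixedPoint → Loc
  | two, p =>
      f₁.inF * toF (series₁ p) (differentiableOn_series₁ p) +
        f₂.inF * toF (series₂ p) (differentiableOn_series₂ p)
  | oneOne, p => f₀.inF * toF (series₀ p) (differentiableOn_series₀ p)

/-- The matrix `E^ell_X`, whose columns are the vectors `E^ell_X(μ)`. -/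
def CanX (f₀ f₁ f₂ : ParamFun) : Matrix FixedPoint FixedPoint F :=
  Matrix.of fun p μ => canX f₀ f₁ f₂ μ p

/-- `E^ell_{-X} = E^ell_X`. -/
def CanNegX (f₀ f₁ f₂ : ParamFun) : Matrix FixedPoint FixedPoint F := CanX f₀ f₁ f₂

/-- The matrix `E^ell_{X!}`, with entries
`E^ell_{X!}(μ!)|_{p!} = (E^ell_X(μ!)|_{p!})|_{a ↔ z}`. -/
def CanDual (f₀ f₁ f₂ : ParamFun) : Matrix FixedPoint FixedPoint F :=
  Matrix.of fun p μ => swap (canX f₀ f₁ f₂ μ.dual p.dual)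

/-- `E^ell_{X!_flop}`: the image of `E^ell_{X!}` under `v ↦ v⁻¹`. -/
def CanDualFlop (f₀ f₁ f₂ : ParamFun) : Matrix FixedPoint FixedPoint F :=
  (CanDual f₀ f₁ f₂).map bar

/-- `∑_m q^{m²} v^{2m}`. -/
def thetaEven (ν τ : ℂ) : ℂ := ∑' m : ℤ, e (m ^ 2 * τ) * e (2 * m * ν)

/-- `∑_m q^{(m+1/2)²} v^{2m+1}`. -/
def thetaOdd (ν τ : ℂ) : ℂ := ∑' m : ℤ, e ((m + 1 / 2) ^ 2 * τ) * e ((2 * m + 1) * ν)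

/-- `(q; q)_∞ = ∏_{m ≥ 1} (1 - q^m)`. -/
def eulerFun (τ : ℂ) : ℂ := ∏' m : ℕ, (1 - e ((m + 1) * τ))

/-- `Υ = q^{1/4} (q; q)_∞² f₀ (f₁ ∑_m q^{m²} v^{2m} + f₂ ∑_m q^{(m+1/2)²} v^{2m+1})`. -/
def upsilonFun (f₀ f₁ f₂ : ParamFun) (ν τ : ℂ) : ℂ :=
  e (τ / 4) * eulerFun τ ^ 2 * (f₀ ν τ * (f₁ ν τ * thetaEven ν τ + f₂ ν τ * thetaOdd ν τ))

theorem thetaEven_eq (ν τ : ℂ) : thetaEven ν τ = jacobiTheta₂ (2 * ν) (2 * τ) := by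
  rw [thetaEven, jacobiTheta₂]
  refine tsum_congr fun m => ?_
  rw [jterm, ← e_add]
  congr 1
  ring

theorem thetaOdd_eq (ν τ : ℂ) :
    thetaOdd ν τ = e (τ / 4 + ν) * jacobiTheta₂ (2 * ν + τ) (2 * τ) := by
  rw [thetaOdd, jacobiTheta₂, ← tsum_mul_left]
  refine tsum_congr fun m => ?_
  rw [jterm, ← e_add, ← e_add]
  congr 1
  ring

theorem differentiableOn_eulerFun : DifferentiableOn ℂ
    (fun x : ℂ × ℂ × ℂ × ℂ => eulerFun x.2.2.2) cover := by
  have heq : ∀ x ∈ cover, eulerFun x.2.2.2 =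
      (fun q : ℂ => ∏' n : ℕ, (1 - q ^ (n + 1))) (e x.2.2.2) := by
    intro x _
    refine tprod_congr fun m => ?_
    rw [← zpow_natCast, e_zpow]
    push_cast
    rfl
  have h1 := differentiable_e
  have h2 : Differentiable ℂ (fun x : ℂ × ℂ × ℂ × ℂ => e x.2.2.2) := by fun_prop
  have h3 : Set.MapsTo (fun x : ℂ × ℂ × ℂ × ℂ => e x.2.2.2) cover (Metric.ball (0 : ℂ) 1) := by
    intro x hx
    have hx' : 0 < x.2.2.2.im := hx
    rw [Metric.mem_ball, dist_zero_right, norm_e, Real.exp_lt_one_iff]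
    have := mul_pos Real.pi_pos hx'
    linarith
  exact (ModularForm.differentiableOn_tprod_one_sub_pow.comp h2.differentiableOn h3).congr heq

theorem differentiableOn_upsilonFun (f₀ f₁ f₂ : ParamFun) : DifferentiableOn ℂ
    (fun x : ℂ × ℂ × ℂ × ℂ => upsilonFun f₀ f₁ f₂ x.2.2.1 x.2.2.2) cover := by
  have h1 := differentiable_e
  simp only [upsilonFun, thetaEven_eq, thetaOdd_eq]
  have hE : DifferentiableOn ℂ (fun x : ℂ × ℂ × ℂ × ℂ =>
      jacobiTheta₂ (2 * x.2.2.1) (2 * x.2.2.2)) cover :=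
    differentiableOn_jacobi (by fun_prop) (by fun_prop) fun x hx => im_two_mul hx
  have hO : DifferentiableOn ℂ (fun x : ℂ × ℂ × ℂ × ℂ => e (x.2.2.2 / 4 + x.2.2.1) *
      jacobiTheta₂ (2 * x.2.2.1 + x.2.2.2) (2 * x.2.2.2)) cover :=
    (Differentiable.differentiableOn (by fun_prop)).mul
      (differentiableOn_jacobi (by fun_prop) (by fun_prop) fun x hx => im_two_mul hx)
  have hq : DifferentiableOn ℂ (fun x : ℂ × ℂ × ℂ × ℂ => e (x.2.2.2 / 4)) cover :=
    Differentiable.differentiableOn (by fun_prop)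
  exact (hq.mul (differentiableOn_eulerFun.pow 2)).mul (f₀.differentiableOn.mul
    ((f₁.differentiableOn.mul hE).add (f₂.differentiableOn.mul hO)))

/-- `Υ(v; q)` as an element of `F`. -/
def Upsilon (f₀ f₁ f₂ : ParamFun) : F :=
  toF (fun _ _ ν τ => upsilonFun f₀ f₁ f₂ ν τ) (differentiableOn_upsilonFun f₀ f₁ f₂)

end EllHilb

end

noncomputable section

namespace EllHilb

open FixedPoint

/-! ### The Jacobi triple product -/

/-! The lattice sums defining the canonical basis factor into theta functions of one variable. Let
`S` be the odd theta series `oddTheta`, which is q^{1/8}(q;q)_∞ϑ by the Jacobi triple product, and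
let `G` = f₁·`thetaEven` + f₂·`thetaOdd`. With s = ±1 at the two fixed points, the vector of [2] has
entries S(a^s z) G(a^{-s}zv) (`canX_two`), and that of [1,1] has entries f₀ S(a^{-s}zv²)
(`canX_oneOne`). Likewise Υ = q^{1/4}(q;q)_∞² f₀ G(v) (`Upsilon_eq`).

Splitting a double sum by parity gives S(xy)S(x/y) = O(x)E(y) - E(x)O(y), with E = `thetaEven` and O
= `thetaOdd` (`oddTheta_mul_oddTheta`). The left side is thus a 2×2 determinant, and G is a linear
form on the same plane. The Plücker relations yield the three-term relation between `S` and `G`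
(`oddTheta_three_term`) and Weierstrass's relation for `S` alone (`weierstrass_three_term`).

Each entry of the matrix products is a sum of two terms. It either cancels by parity or is a
three-term relation whose third argument is v, the argument of `G` in Υ. In the nonzero off-diagonal
entries Weierstrass's relation is also needed, to recover the quotient in the stable basis. This
gives E·ᵗE^! = Υ Stab_X (`canX_mul_canDual`) and, after v ↦ v⁻¹ in the second factor, E·ᵗ(bar E^!) =
-Υ Stab_{-X} (`canX_mul_canDualFlop`).

The involution is β(x) = -Stab_{-X}·bar(Stab_X⁻¹x). Since Υ is bar-invariant and nonzero,
eliminating E^! from the two factorizations gives β(E) = E (`barExtend_fixes`). -/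

theorem e_zero : e 0 = 1 := by simpa using e_int 0

theorem e_ne_zero (x : ℂ) : e x ≠ 0 := Complex.exp_ne_zero _

theorem norm_e_lt_one {x : ℂ} (hx : 0 < x.im) : ‖e x‖ < 1 := by
  rw [norm_e, Real.exp_lt_one_iff]
  have := mul_pos Real.pi_pos hx
  linarith

theorem one_sub_e_ne_zero {x : ℂ} (hx : 0 < x.im) : 1 - e x ≠ 0 := by
  intro h
  have h1 := norm_e_lt_one hx
  rw [← sub_eq_zero.mp h, norm_one] at h1
  exact lt_irrefl _ h1

theorem im_nat_succ_mul {τ : ℂ} (hτ : 0 < τ.im) (m : ℕ) : 0 < ((m + 1 : ℂ) * τ).im := by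
  have : ((m + 1 : ℂ) * τ).im = (m + 1) * τ.im := by simp
  rw [this]
  positivity

theorem summable_norm_e_succ_mul_add {τ : ℂ} (hτ : 0 < τ.im) (u : ℂ) :
    Summable fun m : ℕ => ‖e ((m + 1) * τ + u)‖ := by
  have h : ∀ m : ℕ, ‖e ((m + 1) * τ + u)‖ = ‖e (τ + u)‖ * ‖e τ‖ ^ m := fun m => by
    rw [← norm_pow, ← norm_mul, ← zpow_natCast, e_zpow, ← e_add]
    push_cast
    ring_nf
  simp only [h]
  exact (summable_geometric_of_lt_one (norm_nonneg _) (norm_e_lt_one hτ)).mul_left _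

/-- The finite product `(q; q)_n`. -/
def eulerPartial (τ : ℂ) (n : ℕ) : ℂ := ∏ i ∈ Finset.range n, (1 - e ((i + 1) * τ))

theorem eulerPartial_ne_zero {τ : ℂ} (hτ : 0 < τ.im) (n : ℕ) : eulerPartial τ n ≠ 0 :=
  Finset.prod_ne_zero_iff.mpr fun i _ => one_sub_e_ne_zero (im_nat_succ_mul hτ i)

theorem eulerPartial_succ (τ : ℂ) (n : ℕ) :
    eulerPartial τ (n + 1) = eulerPartial τ n * (1 - e ((n + 1) * τ)) :=
  Finset.prod_range_succ _ _

theorem summable_norm_neg_e_succ_mul {τ : ℂ} (hτ : 0 < τ.im) :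
    Summable fun m : ℕ => ‖-e ((m + 1) * τ)‖ := by
  simpa using summable_norm_e_succ_mul_add hτ 0

theorem tendsto_eulerPartial {τ : ℂ} (hτ : 0 < τ.im) :
    Tendsto (eulerPartial τ) atTop (𝓝 (eulerFun τ)) := by
  have := (multipliable_one_add_of_summable (summable_norm_neg_e_succ_mul hτ)).hasProd
  have h2 := this.tendsto_prod_nat
  simp only [← sub_eq_add_neg] at h2
  exact h2

theorem eulerFun_ne_zero {τ : ℂ} (hτ : 0 < τ.im) : eulerFun τ ≠ 0 := by
  have := tprod_one_add_ne_zero_of_summable (f := fun m : ℕ => -e ((m + 1) * τ))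
    (fun m => by simpa [← sub_eq_add_neg] using one_sub_e_ne_zero (im_nat_succ_mul hτ m))
    (summable_norm_neg_e_succ_mul hτ)
  simpa [eulerFun, ← sub_eq_add_neg] using this

/-- `1 / (q; q)_n`, extended by zero to negative `n`. -/
def invEuler (τ : ℂ) (n : ℤ) : ℂ := if n < 0 then 0 else (eulerPartial τ n.toNat)⁻¹

theorem invEuler_natCast (τ : ℂ) (n : ℕ) : invEuler τ n = (eulerPartial τ n)⁻¹ := by
  simp [invEuler]

/-- Extension by zero keeps the recursion valid for every integer: at n = 0 the factor 1 - q^n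
vanishes. -/
theorem invEuler_mul {τ : ℂ} (hτ : 0 < τ.im) (n : ℤ) :
    invEuler τ n * (1 - e (n * τ)) = invEuler τ (n - 1) := by
  rcases lt_trichotomy n 0 with h | rfl | h
  · simp [invEuler, h, show n - 1 < 0 by omega]
  · simp [invEuler, e_zero]
  · obtain ⟨k, rfl⟩ : ∃ k : ℕ, n = k + 1 := ⟨(n - 1).toNat, by omega⟩
    rw [add_sub_cancel_right, invEuler_natCast, ← Nat.cast_add_one, invEuler_natCast,
      eulerPartial_succ]
    push_cast
    have := one_sub_e_ne_zero (im_nat_succ_mul hτ k)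
    field_simp

theorem tendsto_invEuler {τ : ℂ} (hτ : 0 < τ.im) :
    Tendsto (invEuler τ) atTop (𝓝 (eulerFun τ)⁻¹) := by
  have h1 : Tendsto (fun n : ℤ => (eulerPartial τ n.toNat)⁻¹) atTop (𝓝 (eulerFun τ)⁻¹) :=
    ((tendsto_eulerPartial hτ).inv₀ (eulerFun_ne_zero hτ)).comp
      (tendsto_atTop_atTop.mpr fun b => ⟨b, fun a ha => by omega⟩)
  refine h1.congr' ?_
  filter_upwards [eventually_ge_atTop 0] with n hn
  simp [invEuler, hn.not_gt]

theorem exists_norm_invEuler_le {τ : ℂ} (hτ : 0 < τ.im) : ∃ C, ∀ n, ‖invEuler τ n‖ ≤ C := by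
  obtain ⟨C, hC⟩ := ((tendsto_eulerPartial hτ).inv₀ (eulerFun_ne_zero hτ)).norm.bddAbove_range
  refine ⟨C, fun n => ?_⟩
  have h := fun k : ℕ => hC ⟨k, rfl⟩
  rw [invEuler]
  split_ifs
  · simpa using (norm_nonneg _).trans (h 0)
  · exact h _

theorem exists_norm_eulerPartial_le {τ : ℂ} (hτ : 0 < τ.im) :
    ∃ C, ∀ n, ‖eulerPartial τ n‖ ≤ C := by
  obtain ⟨C, hC⟩ := (tendsto_eulerPartial hτ).norm.bddAbove_range
  exact ⟨C, fun n => hC ⟨n, rfl⟩⟩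

/-- The central Gaussian binomial coefficient `[2N+1; N+m]`. -/
def gaussCentral (τ : ℂ) (N : ℕ) (m : ℤ) : ℂ :=
  eulerPartial τ (2 * N + 1) * (invEuler τ (N + m) * invEuler τ (N + 1 - m))

/-- Uniformity in both N and m supplies the dominating series when N → ∞ in the finite triple
product. -/
theorem exists_norm_gaussCentral_le {τ : ℂ} (hτ : 0 < τ.im) :
    ∃ C, ∀ N m, ‖gaussCentral τ N m‖ ≤ C := by
  obtain ⟨C, hC⟩ := exists_norm_invEuler_le hτ
  obtain ⟨D, hD⟩ := exists_norm_eulerPartial_le hτ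
  have hC0 : 0 ≤ C := (norm_nonneg _).trans (hC 0)
  have hD0 : 0 ≤ D := (norm_nonneg _).trans (hD 0)
  refine ⟨D * (C * C), fun N m => ?_⟩
  rw [gaussCentral, norm_mul, norm_mul]
  gcongr <;> apply_assumption

theorem tendsto_gaussCentral {τ : ℂ} (hτ : 0 < τ.im) (m : ℤ) :
    Tendsto (fun N => gaussCentral τ N m) atTop (𝓝 (eulerFun τ)⁻¹) := by
  have h1 : Tendsto (fun N : ℕ => eulerPartial τ (2 * N + 1)) atTop (𝓝 (eulerFun τ)) :=
    (tendsto_eulerPartial hτ).comp (tendsto_atTop_mono (fun N => by simp; omega) tendsto_id)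
  have h2 : Tendsto (fun N : ℕ => invEuler τ (N + m)) atTop (𝓝 (eulerFun τ)⁻¹) :=
    (tendsto_invEuler hτ).comp
      (tendsto_atTop_add_const_right _ m tendsto_natCast_atTop_atTop)
  have h3 : Tendsto (fun N : ℕ => invEuler τ (N + 1 - m)) atTop (𝓝 (eulerFun τ)⁻¹) := by
    have h : ∀ N : ℕ, (N : ℤ) + 1 - m = N + (1 - m) := fun N => by ring
    simp only [h]
    exact (tendsto_invEuler hτ).comp
      (tendsto_atTop_add_const_right _ (1 - m) tendsto_natCast_atTop_atTop)
  have := h1.mul (h2.mul h3)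
  rwa [mul_inv_cancel_left₀ (eulerFun_ne_zero hτ)] at this

/-- A double step of the q-Pascal rule. Every reciprocal that occurs is a polynomial multiple of `r`
or `s`, the ones of largest index, so the claim becomes a polynomial identity. -/
theorem gaussCentral_succ {τ : ℂ} (hτ : 0 < τ.im) (N : ℕ) (m : ℤ) :
    gaussCentral τ (N + 1) m = (1 + e ((2 * N + 2) * τ)) * gaussCentral τ N m +
      e ((N + 2 - m) * τ) * gaussCentral τ N (m - 1) +
      e ((N + 1 + m) * τ) * gaussCentral τ N (m + 1) := by
  set r := invEuler τ (N + 1 + m) with hr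
  set s := invEuler τ (N + 2 - m) with hs
  have r1 : invEuler τ (N + m) = r * (1 - e ((N + 1 + m) * τ)) := by
    have := invEuler_mul hτ (N + 1 + m)
    push_cast at this
    rw [hr, this]; congr 1; ring
  have s1 : invEuler τ (N + 1 - m) = s * (1 - e ((N + 2 - m) * τ)) := by
    have := invEuler_mul hτ (N + 2 - m)
    push_cast at this
    rw [hs, this]; congr 1; ring
  have r2 : invEuler τ (N + (m - 1)) = invEuler τ (N + m) * (1 - e ((N + m) * τ)) := by
    have := invEuler_mul hτ (N + m)
    push_cast at this
    rw [this]; congr 1; ring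
  have s2 : invEuler τ (N + 1 - (m + 1)) = invEuler τ (N + 1 - m) * (1 - e ((N + 1 - m) * τ)) := by
    have := invEuler_mul hτ (N + 1 - m)
    push_cast at this
    rw [this]; congr 1; ring
  have hr' : invEuler τ ((N + 1 : ℕ) + m) = r := by rw [hr]; push_cast; ring_nf
  have hs' : invEuler τ ((N + 1 : ℕ) + 1 - m) = s := by rw [hs]; push_cast; ring_nf
  have hr'' : invEuler τ (N + (m + 1)) = r := by rw [hr]; congr 1; ring
  have hs'' : invEuler τ (N + 1 - (m - 1)) = s := by rw [hs]; congr 1; ring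
  have hP : eulerPartial τ (2 * (N + 1) + 1) = eulerPartial τ (2 * N + 1) *
      (1 - e ((2 * N + 2) * τ)) * (1 - e ((2 * N + 3) * τ)) := by
    rw [show 2 * (N + 1) + 1 = 2 * N + 1 + 1 + 1 by ring, eulerPartial_succ, eulerPartial_succ]
    push_cast
    ring_nf
  have hu : e ((N + 1 + m) * τ) = e ((N + m) * τ) * e τ := by rw [← e_add]; ring_nf
  have hw : e ((N + 2 - m) * τ) = e ((N + 1 - m) * τ) * e τ := by rw [← e_add]; ring_nf
  have h2 : e ((2 * N + 2) * τ) = e ((N + m) * τ) * e ((N + 1 - m) * τ) * e τ := by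
    rw [← e_add, ← e_add]; ring_nf
  have h3 : e ((2 * N + 3) * τ) = e ((N + m) * τ) * e ((N + 1 - m) * τ) * e τ * e τ := by
    rw [← e_add, ← e_add, ← e_add]; ring_nf
  simp only [gaussCentral, hr', hs', hr'', hs'', r2, s2, r1, s1, hP]
  rw [h2, h3, hu, hw]
  ring

/-- `(-1)^m q^{m(m-1)/2} x^m`, at `x = e u`. -/
def tripleTerm (u τ : ℂ) (m : ℤ) : ℂ := jacobiTheta₂_term m (u - τ / 2 + 1 / 2) τ

theorem tripleTerm_eq (u τ : ℂ) (m : ℤ) :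
    tripleTerm u τ m = e (m * (1 / 2) + m * (m - 1) / 2 * τ + m * u) := by
  rw [tripleTerm, jterm]; congr 1; ring

/-- Multiplication by x amounts to an index shift at the cost of a power of q; this matches the
shifted terms of `gaussCentral_succ`. -/
theorem tripleTerm_pred (u τ : ℂ) (m : ℤ) :
    e u * tripleTerm u τ (m - 1) = -(e ((1 - m) * τ) * tripleTerm u τ m) := by
  rw [neg_eq_neg_one_mul, ← e_half, tripleTerm_eq, tripleTerm_eq, ← e_add, ← e_add, ← e_add]
  have h : e ((m - 1 : ℤ) * (1 / 2) : ℂ) = e (1 / 2 + m * (1 / 2)) := by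
    rw [show (1 / 2 + m * (1 / 2) : ℂ) = (m - 1 : ℤ) * (1 / 2) + (1 : ℤ) by push_cast; ring,
      e_add _ ((1 : ℤ) : ℂ), e_int, mul_one]
  rw [show u + (((m - 1 : ℤ) : ℂ) * (1 / 2) + (m - 1 : ℤ) * ((m - 1 : ℤ) - 1) / 2 * τ +
      (m - 1 : ℤ) * u) = ((m - 1 : ℤ) * (1 / 2)) +
      ((1 - m) * τ + (m * (m - 1) / 2 * τ + m * u)) by push_cast; ring, e_add, h, ← e_add]
  congr 1
  ring

theorem tripleTerm_succ (u τ : ℂ) (m : ℤ) :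
    e (-u) * tripleTerm u τ (m + 1) = -(e (m * τ) * tripleTerm u τ m) := by
  have h := tripleTerm_pred u τ (m + 1)
  rw [add_sub_cancel_right] at h
  have h2 : e (m * τ) * e ((1 - (m + 1 : ℤ)) * τ) = 1 := by
    rw [← e_add, ← add_mul, show (m + (1 - (m + 1 : ℤ)) : ℂ) = 0 by push_cast; ring, zero_mul,
      e_zero]
  have h3 : e (-u) * e u = 1 := by rw [← e_add, ← e_zero]; congr 1; ring
  linear_combination (-tripleTerm u τ (m + 1) * e (-u)) * h2 + e (-u) * e (m * τ) * h -
    e (m * τ) * tripleTerm u τ m * h3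

theorem summable_norm_tripleTerm (u : ℂ) {τ : ℂ} (hτ : 0 < τ.im) :
    Summable fun m => ‖tripleTerm u τ m‖ := summable_norm_jterm _ hτ

theorem summable_gaussCentral_mul_tripleTerm (u : ℂ) {τ : ℂ} (hτ : 0 < τ.im) (N : ℕ) :
    Summable fun m => gaussCentral τ N m * tripleTerm u τ m := by
  obtain ⟨C, hC⟩ := exists_norm_gaussCentral_le hτ
  refine ((summable_norm_tripleTerm u hτ).mul_left C).of_norm_bounded fun m => ?_
  rw [norm_mul]
  gcongr
  exact hC N m

/-- The finite form of the Jacobi triple product. -/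
theorem finite_triple_product (u : ℂ) {τ : ℂ} (hτ : 0 < τ.im) (N : ℕ) :
    (1 - e u) * ∏ i ∈ Finset.range N, ((1 - e ((i + 1) * τ + u)) * (1 - e ((i + 1) * τ - u))) =
      ∑' m, gaussCentral τ N m * tripleTerm u τ m := by
  induction N with
  | zero =>
    -- For N = 0 the two indices are m and 1 - m, and both must be nonnegative.
    have hsupp : ∀ m ∉ ({0, 1} : Finset ℤ), gaussCentral τ 0 m * tripleTerm u τ m = 0 := by
      intro m hm
      simp only [Finset.mem_insert, Finset.mem_singleton, not_or] at hm
      rcases lt_or_gt_of_ne hm.1 with h | h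
      · simp [gaussCentral, invEuler, h]
      · simp [gaussCentral, invEuler, show 1 < m by omega]
    rw [tsum_eq_sum hsupp, Finset.sum_pair (by decide)]
    have h1 : eulerPartial τ 1 ≠ 0 := eulerPartial_ne_zero hτ 1
    have h0 : eulerPartial τ 0 = 1 := by simp [eulerPartial]
    simp [gaussCentral, invEuler, tripleTerm_eq, h0, mul_inv_cancel₀ h1, e_zero, e_add]
    rw [show (2⁻¹ : ℂ) = 1 / 2 by norm_num, e_half]
    ring
  | succ N ih =>
    have hS := summable_gaussCentral_mul_tripleTerm u hτ N
    set f := fun m => gaussCentral τ N m * tripleTerm u τ m with hf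
    have hp : ∑' m, f (m - 1) = ∑' m, f m := (Equiv.subRight (1 : ℤ)).tsum_eq f
    have hq : ∑' m, f (m + 1) = ∑' m, f m := (Equiv.addRight (1 : ℤ)).tsum_eq f
    have hSp : Summable fun m => f (m - 1) :=
      hS.comp_injective (Equiv.subRight (1 : ℤ)).injective
    have hSq : Summable fun m => f (m + 1) :=
      hS.comp_injective (Equiv.addRight (1 : ℤ)).injective
    -- The coefficients are those of (1 - q^{N+1}x)(1 - q^{N+1}x⁻¹), the new pair of factors; the
    -- shifts by ±1 do not change the sum over ℤ.
    have hterm : ∀ m, gaussCentral τ (N + 1) m * tripleTerm u τ m =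
        (1 + e ((2 * N + 2) * τ)) * f m + (-(e ((N + 1) * τ) * e u)) * f (m - 1) +
          (-(e ((N + 1) * τ) * e (-u))) * f (m + 1) := by
      intro m
      have h1 : e ((N + 2 - m) * τ) = e ((N + 1) * τ) * e ((1 - m) * τ) := by
        rw [← e_add]; ring_nf
      have h2 : e ((N + 1 + m) * τ) = e ((N + 1) * τ) * e (m * τ) := by
        rw [← e_add]; ring_nf
      rw [gaussCentral_succ hτ, h1, h2]
      simp only [hf]
      linear_combination
        e ((N + 1) * τ) * gaussCentral τ N (m - 1) * tripleTerm_pred u τ m +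
        e ((N + 1) * τ) * gaussCentral τ N (m + 1) * tripleTerm_succ u τ m
    rw [tsum_congr hterm, ((hS.mul_left _).add (hSp.mul_left _)).tsum_add (hSq.mul_left _),
      (hS.mul_left _).tsum_add (hSp.mul_left _), tsum_mul_left, tsum_mul_left, tsum_mul_left,
      hp, hq, ← ih, Finset.prod_range_succ, sub_eq_add_neg _ u, e_add _ u, e_add _ (-u)]
    have h3 : e u * e (-u) = 1 := by rw [← e_add, ← e_zero]; congr 1; ring
    have h4 : e ((2 * N + 2) * τ) = e ((N + 1) * τ) * e ((N + 1) * τ) := by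
      rw [← e_add]; ring_nf
    rw [h4]
    linear_combination (1 - e u) * (∏ i ∈ Finset.range N,
      ((1 - e ((i + 1) * τ + u)) * (1 - e ((i + 1) * τ - u)))) *
      e ((N + 1) * τ) * e ((N + 1) * τ) * h3

theorem multipliable_one_sub_e_succ_mul_add (u : ℂ) {τ : ℂ} (hτ : 0 < τ.im) :
    Multipliable fun m : ℕ => 1 - e ((m + 1) * τ + u) := by
  simpa [← sub_eq_add_neg] using multipliable_one_add_of_summable
    (f := fun m : ℕ => -e ((m + 1) * τ + u)) (by simpa using summable_norm_e_succ_mul_add hτ u)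

theorem multipliable_thetaFactor (u : ℂ) {τ : ℂ} (hτ : 0 < τ.im) :
    Multipliable fun m : ℕ => (1 - e ((m + 1) * τ + u)) * (1 - e ((m + 1) * τ - u)) := by
  simpa [← sub_eq_add_neg] using (multipliable_one_sub_e_succ_mul_add u hτ).mul
    (multipliable_one_sub_e_succ_mul_add (-u) hτ)

/-- The Jacobi triple product. -/
theorem triple_product (u : ℂ) {τ : ℂ} (hτ : 0 < τ.im) :
    eulerFun τ * ((1 - e u) * ∏' m : ℕ, ((1 - e ((m + 1) * τ + u)) * (1 - e ((m + 1) * τ - u)))) =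
      ∑' m, tripleTerm u τ m := by
  obtain ⟨C, hC⟩ := exists_norm_gaussCentral_le hτ
  -- Dominated convergence: each Gaussian coefficient tends to 1/(q;q)_∞.
  have h1 : Tendsto (fun N => ∑' m, gaussCentral τ N m * tripleTerm u τ m) atTop
      (𝓝 (∑' m, (eulerFun τ)⁻¹ * tripleTerm u τ m)) := by
    refine tendsto_tsum_of_dominated_convergence ((summable_norm_tripleTerm u hτ).mul_left C)
      (fun m => (tendsto_gaussCentral hτ m).mul_const _) (Eventually.of_forall fun N m => ?_)
    rw [norm_mul]
    gcongr
    exact hC N m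
  have h2 := ((multipliable_thetaFactor u hτ).hasProd.tendsto_prod_nat).const_mul (1 - e u)
  rw [tendsto_nhds_unique (h2.congr (finite_triple_product u hτ)) h1, tsum_mul_left,
    mul_inv_cancel_left₀ (eulerFun_ne_zero hτ)]

/-- `∑_m (-1)^m q^{(m+1/2)²/2} x^{m+1/2}` at `x = e u`. -/
def oddTheta (u τ : ℂ) : ℂ :=
  ∑' m : ℤ, (-1) ^ m * e ((m + 1 / 2) ^ 2 / 2 * τ) * e ((m + 1 / 2) * u)

theorem oddTheta_eq_jacobi (u τ : ℂ) :
    oddTheta u τ = e (τ / 8 + u / 2) * jacobiTheta₂ (u + τ / 2 + 1 / 2) τ := by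
  rw [oddTheta, jacobiTheta₂, ← tsum_mul_left]
  refine tsum_congr fun m => ?_
  rw [jterm, neg_one_zpow_eq, ← e_add, ← e_add, ← e_add]
  congr 1
  ring

theorem oddTheta_eq (u : ℂ) {τ : ℂ} (hτ : 0 < τ.im) :
    oddTheta u τ = e (τ / 8) * eulerFun τ * thetaFun u τ := by
  have h := triple_product u hτ
  -- The shift m ↦ m + 1 turns m(m-1)/2 into (m+1/2)²/2 - 1/8 and produces the sign.
  have h2 : ∑' m, tripleTerm u τ m = -(e (-(τ / 8) + u / 2) * oddTheta u τ) := by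
    rw [oddTheta, ← tsum_mul_left, ← tsum_neg, ← (Equiv.addRight (1 : ℤ)).tsum_eq]
    refine tsum_congr fun m => ?_
    rw [neg_one_zpow_eq, neg_eq_neg_one_mul, ← e_half, tripleTerm_eq, ← e_add, ← e_add, ← e_add,
      ← e_add, Equiv.coe_addRight]
    congr 1
    push_cast
    ring
  have h3 : e (τ / 8) * e (-(u / 2)) * e (-(τ / 8) + u / 2) = 1 := by
    rw [← e_add, ← e_add, ← e_zero]; congr 1; ring
  have h4 : e u = e (u / 2) * e (u / 2) := by rw [← e_add]; congr 1; ring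
  have h5 : e (u / 2) * e (-(u / 2)) = 1 := by rw [← e_add, ← e_zero]; congr 1; ring
  rw [h2, h4] at h
  rw [thetaFun]
  set T := ∏' m : ℕ, ((1 - e ((m + 1) * τ + u)) * (1 - e ((m + 1) * τ - u)))
  linear_combination (-oddTheta u τ) * h3 + e (τ / 8) * e (-(u / 2)) * h +
    e (τ / 8) * eulerFun τ * T * e (u / 2) * h5

/-- At x = i the prefactor is nonzero because x ≠ 1, and no factor 1 - q^m i^{±1} vanishes because
|q| < 1. This point is the witness for all later nonvanishing claims. -/
theorem thetaFun_quarter_ne_zero {τ : ℂ} (hτ : 0 < τ.im) : thetaFun (1 / 4) τ ≠ 0 := by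
  have h0 : ∀ (m : ℕ) (s : ℝ), 0 < ((m + 1) * τ + s).im := fun m s => by
    simpa using im_nat_succ_mul hτ m
  have hs : ∀ s : ℝ, ∏' m : ℕ, (1 - e ((m + 1) * τ + s)) ≠ 0 := fun s => by
    have := tprod_one_add_ne_zero_of_summable (f := fun m : ℕ => -e ((m + 1) * τ + s))
      (fun m => by simpa [← sub_eq_add_neg] using one_sub_e_ne_zero (h0 m s))
      (by simpa using summable_norm_e_succ_mul_add hτ s)
    simpa [← sub_eq_add_neg] using this
  refine mul_ne_zero ?_ ?_
  · intro h
    have h1 : e (1 / 4 / 2) * e (1 / 4 / 2) = e (1 / 4) := by rw [← e_add]; congr 1; ring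
    have h2 : e (1 / 4 / 2) * e (-(1 / 4 / 2)) = 1 := by
      rw [← e_add, ← e_zero]; congr 1; ring
    have h3 : e (1 / 4) * e (1 / 4) = -1 := by rw [← e_add, ← e_half]; congr 1; ring
    have h4 : e (1 / 4) = 1 := by linear_combination e (1 / 4 / 2) * h - h1 + h2
    rw [h4] at h3
    norm_num at h3
  · have h1 := hs (1 / 4)
    have h2 := hs (-(1 / 4))
    push_cast at h1 h2
    have := (multipliable_one_sub_e_succ_mul_add (1 / 4) hτ).tprod_mul
      (multipliable_one_sub_e_succ_mul_add (-(1 / 4)) hτ)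
    simp only [sub_eq_add_neg _ (1 / 4 : ℂ)]
    rw [this]
    exact mul_ne_zero h1 h2

/-! ### Addition formulas for theta functions -/

theorem thetaFun_neg (u τ : ℂ) : thetaFun (-u) τ = -thetaFun u τ := by
  have h : ∏' m : ℕ, ((1 - e ((m + 1) * τ + -u)) * (1 - e ((m + 1) * τ - -u))) =
      ∏' m : ℕ, ((1 - e ((m + 1) * τ + u)) * (1 - e ((m + 1) * τ - u))) :=
    tprod_congr fun m => by rw [sub_neg_eq_add, ← sub_eq_add_neg, mul_comm]
  rw [thetaFun, thetaFun, h, neg_div, neg_neg]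
  ring

theorem oddTheta_neg (u : ℂ) {τ : ℂ} (hτ : 0 < τ.im) : oddTheta (-u) τ = -oddTheta u τ := by
  rw [oddTheta_eq _ hτ, oddTheta_eq _ hτ, thetaFun_neg]
  ring

theorem thetaEven_neg (u τ : ℂ) : thetaEven (-u) τ = thetaEven u τ := by
  rw [thetaEven_eq, thetaEven_eq, ← jacobiTheta₂_neg_left]
  congr 1
  ring

theorem thetaOdd_neg (u τ : ℂ) : thetaOdd (-u) τ = thetaOdd u τ := by
  rw [thetaOdd, thetaOdd, ← (Equiv.subLeft (-1 : ℤ)).tsum_eq]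
  refine tsum_congr fun m => ?_
  rw [Equiv.subLeft_apply, ← e_add, ← e_add]
  congr 1
  push_cast
  ring

/-! ### Products of theta series, by splitting double sums according to parity. -/

theorem summable_norm_mul_left (c : ℂ) {f : ℤ → ℂ} (hf : Summable fun m => ‖f m‖) :
    Summable fun m => ‖c * f m‖ := by
  simpa only [norm_mul] using hf.mul_left ‖c‖

theorem summable_norm_oddTheta_term (u : ℂ) {τ : ℂ} (hτ : 0 < τ.im) :
    Summable fun m : ℤ => ‖(-1) ^ m * e ((m + 1 / 2) ^ 2 / 2 * τ) * e ((m + 1 / 2) * u)‖ := by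
  refine (summable_norm_mul_left (e (τ / 8 + u / 2))
    (summable_norm_jterm (u + τ / 2 + 1 / 2) hτ)).congr fun m => ?_
  rw [jterm, neg_one_zpow_eq, ← e_add, ← e_add, ← e_add]
  congr 2
  ring

theorem summable_norm_thetaEven_term (u : ℂ) {τ : ℂ} (hτ : 0 < τ.im) :
    Summable fun m : ℤ => ‖e (m ^ 2 * τ) * e (2 * m * u)‖ := by
  refine (summable_norm_jterm (2 * u) (τ := 2 * τ) (by simpa using hτ)).congr fun m => ?_
  rw [jterm, ← e_add]
  congr 2
  ring

theorem summable_norm_thetaOdd_term (u : ℂ) {τ : ℂ} (hτ : 0 < τ.im) :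
    Summable fun m : ℤ => ‖e ((m + 1 / 2) ^ 2 * τ) * e ((2 * m + 1) * u)‖ := by
  refine (summable_norm_mul_left (e (τ / 4 + u)) (summable_norm_jterm (2 * u + τ) (τ := 2 * τ)
    (by simpa using hτ))).congr fun m => ?_
  rw [jterm, ← e_add, ← e_add]
  congr 2
  ring

/-- Pairs of integers with even sum and with odd sum. -/
theorem isCompl_range_parity :
    IsCompl (Set.range fun p : ℤ × ℤ => (p.1 + p.2, p.1 - p.2))
      (Set.range fun p : ℤ × ℤ => (p.1 + p.2, p.1 - p.2 - 1)) := by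
  constructor
  · rw [Set.disjoint_left]
    rintro _ ⟨p, rfl⟩ ⟨r, hr⟩
    simp only [Prod.mk.injEq] at hr
    omega
  · rw [codisjoint_iff_le_sup]
    rintro ⟨m, n⟩ -
    rcases Int.even_or_odd' (m + n) with ⟨k, hk | hk⟩
    · exact Or.inl ⟨(k, m - k), by ext <;> dsimp only <;> omega⟩
    · exact Or.inr ⟨(k + 1, m - k - 1), by ext <;> dsimp only <;> omega⟩

theorem hasSum_of_parity {f : ℤ × ℤ → ℂ} {s t : ℂ}
    (hs : HasSum (fun p : ℤ × ℤ => f (p.1 + p.2, p.1 - p.2)) s)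
    (ht : HasSum (fun p : ℤ × ℤ => f (p.1 + p.2, p.1 - p.2 - 1)) t) : HasSum f (s + t) := by
  have i1 : Function.Injective fun p : ℤ × ℤ => (p.1 + p.2, p.1 - p.2) := fun p r h => by
    simp only [Prod.mk.injEq] at h
    ext <;> omega
  have i2 : Function.Injective fun p : ℤ × ℤ => (p.1 + p.2, p.1 - p.2 - 1) := fun p r h => by
    simp only [Prod.mk.injEq] at h
    ext <;> omega
  exact HasSum.add_isCompl isCompl_range_parity (i1.hasSum_range_iff.mpr hs)
    (i2.hasSum_range_iff.mpr ht)

theorem tsum_mul_tsum_of_parity {f g a b c d : ℤ → ℂ} (hf : Summable fun m => ‖f m‖)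
    (hg : Summable fun m => ‖g m‖) (ha : Summable fun m => ‖a m‖) (hb : Summable fun m => ‖b m‖)
    (hc : Summable fun m => ‖c m‖) (hd : Summable fun m => ‖d m‖)
    (h1 : ∀ i j, f (i + j) * g (i - j) = a i * b j)
    (h2 : ∀ i j, f (i + j) * g (i - j - 1) = -(c i * d j)) :
    (∑' m, f m) * ∑' m, g m = (∑' m, a m) * (∑' m, b m) - (∑' m, c m) * ∑' m, d m := by
  rw [tsum_mul_tsum_of_summable_norm hf hg, tsum_mul_tsum_of_summable_norm ha hb,
    tsum_mul_tsum_of_summable_norm hc hd, sub_eq_add_neg]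
  refine (hasSum_of_parity ?_ ?_).tsum_eq
  · simpa only [h1] using (summable_mul_of_summable_norm ha hb).hasSum
  · simpa only [h2] using (summable_mul_of_summable_norm hc hd).hasSum.neg

theorem e_add_int (x : ℂ) (n : ℤ) : e (x + n) = e x := by rw [e_add, e_int, mul_one]

theorem neg_e (x : ℂ) : -e x = e (x + 1 / 2) := by rw [e_add, e_half, mul_neg_one]

/-- In the double sum over (m, n) the exponents of x and y are m+n+1 and m-n. They have opposite
parities, and the two cases give the two products, the second with sign (-1)^{m+n} = -1. -/
theorem oddTheta_mul_oddTheta (x y : ℂ) {τ : ℂ} (hτ : 0 < τ.im) :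
    oddTheta (x + y) τ * oddTheta (x - y) τ =
      thetaOdd x τ * thetaEven y τ - thetaEven x τ * thetaOdd y τ := by
  refine tsum_mul_tsum_of_parity (summable_norm_oddTheta_term _ hτ)
    (summable_norm_oddTheta_term _ hτ) (summable_norm_thetaOdd_term x hτ)
    (summable_norm_thetaEven_term y hτ) (summable_norm_thetaEven_term x hτ)
    (summable_norm_thetaOdd_term y hτ) (fun i j => ?_) (fun i j => ?_)
  · simp only [neg_one_zpow_eq, ← e_add]
    conv_rhs => rw [← e_add_int _ i]
    congr 1
    push_cast
    ring
  · simp only [neg_one_zpow_eq, ← e_add]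
    conv_rhs => rw [neg_e, ← e_add_int _ (i - 1)]
    congr 1
    push_cast
    ring

/-- The general combination of `thetaEven` and `thetaOdd`. -/
def degTwoTheta (s t u τ : ℂ) : ℂ := s * thetaEven u τ + t * thetaOdd u τ

theorem degTwoTheta_neg (s t u τ : ℂ) : degTwoTheta s t (-u) τ = degTwoTheta s t u τ := by
  rw [degTwoTheta, thetaEven_neg, thetaOdd_neg, degTwoTheta]

/-- The products of odd thetas are the 2×2 minors of the vectors (`thetaEven`, `thetaOdd`) at x, y,
w; this is the linear dependence of three vectors in a plane, under the linear form with
coefficients s, t. -/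
theorem oddTheta_three_term (s t x y w : ℂ) {τ : ℂ} (hτ : 0 < τ.im) :
    oddTheta (x + w) τ * oddTheta (x - w) τ * degTwoTheta s t y τ -
      oddTheta (y + w) τ * oddTheta (y - w) τ * degTwoTheta s t x τ =
    oddTheta (x + y) τ * oddTheta (x - y) τ * degTwoTheta s t w τ := by
  simp only [oddTheta_mul_oddTheta _ _ hτ, degTwoTheta]
  ring

/-- Weierstrass's three-term relation. -/
theorem weierstrass_three_term (x y z w : ℂ) {τ : ℂ} (hτ : 0 < τ.im) :
    (oddTheta (x + y) τ * oddTheta (x - y) τ) * (oddTheta (z + w) τ * oddTheta (z - w) τ) -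
      (oddTheta (x + z) τ * oddTheta (x - z) τ) * (oddTheta (y + w) τ * oddTheta (y - w) τ) +
      (oddTheta (x + w) τ * oddTheta (x - w) τ) * (oddTheta (y + z) τ * oddTheta (y - z) τ) =
    0 := by
  simp only [oddTheta_mul_oddTheta _ _ hτ]
  ring

/-- Weierstrass's relation in the shape needed for the numerator of the off-diagonal stable entries.
-/
theorem oddTheta_four_term (x y w : ℂ) {τ : ℂ} (hτ : 0 < τ.im) :
    oddTheta (y - x) τ * oddTheta (x + y + (x + y)) τ * oddTheta (x + w) τ * oddTheta (y + w) τ =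
      oddTheta (x + y) τ * (oddTheta (x + x) τ * oddTheta (x + y + y + w) τ * oddTheta (y - w) τ -
        oddTheta (x - w) τ * oddTheta (x + x + y + w) τ * oddTheta (y + y) τ) := by
  -- The half-integral arguments are chosen so that all sums and differences are integral in x, y,
  -- w, hence specialize to characters.
  have h := weierstrass_three_term ((x + 3 * y) / 2) ((3 * x + y) / 2) ((x + y) / 2 + w)
    ((x - y) / 2) hτ
  rw [show (x + 3 * y) / 2 + (3 * x + y) / 2 = x + y + (x + y) by ring,
    show (x + 3 * y) / 2 - (3 * x + y) / 2 = y - x by ring,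
    show (x + y) / 2 + w + (x - y) / 2 = x + w by ring,
    show (x + y) / 2 + w - (x - y) / 2 = y + w by ring,
    show (x + 3 * y) / 2 + ((x + y) / 2 + w) = x + y + y + w by ring,
    show (x + 3 * y) / 2 - ((x + y) / 2 + w) = y - w by ring,
    show (3 * x + y) / 2 + (x - y) / 2 = x + x by ring,
    show (3 * x + y) / 2 - (x - y) / 2 = x + y by ring,
    show (x + 3 * y) / 2 + (x - y) / 2 = x + y by ring,
    show (x + 3 * y) / 2 - (x - y) / 2 = y + y by ring,
    show (3 * x + y) / 2 + ((x + y) / 2 + w) = x + x + y + w by ring,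
    show (3 * x + y) / 2 - ((x + y) / 2 + w) = x - w by ring] at h
  linear_combination h

/-! ### Special values of the theta series at i. -/

theorem thetaOdd_quarter (τ : ℂ) : thetaOdd (1 / 4) τ = 0 := by
  have h : thetaOdd (1 / 4) τ = -thetaOdd (-(1 / 4)) τ := by
    rw [thetaOdd, thetaOdd, ← tsum_neg]
    refine tsum_congr fun m => ?_
    have h1 : e ((2 * m + 1) * (1 / 4)) = e (1 / 2) * e m * e ((2 * m + 1) * -(1 / 4)) := by
      rw [← e_add, ← e_add]; congr 1; ring
    rw [h1, e_half, e_int]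
    ring
  rw [thetaOdd_neg] at h
  exact self_eq_neg.mp h

theorem oddTheta_quarter_ne_zero {τ : ℂ} (hτ : 0 < τ.im) : oddTheta (1 / 4) τ ≠ 0 := by
  rw [oddTheta_eq _ hτ]
  exact mul_ne_zero (mul_ne_zero (e_ne_zero _) (eulerFun_ne_zero hτ))
    (thetaFun_quarter_ne_zero hτ)

theorem thetaEven_quarter_ne_zero {τ : ℂ} (hτ : 0 < τ.im) : thetaEven (1 / 4) τ ≠ 0 := by
  intro h
  -- If `thetaEven` vanished here as well as `thetaOdd`, this formula would make the square of
  -- `oddTheta` at 1/4 zero.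
  have h1 := oddTheta_mul_oddTheta 0 (1 / 4) hτ
  rw [h, thetaOdd_quarter, zero_add, zero_sub, oddTheta_neg _ hτ] at h1
  have := oddTheta_quarter_ne_zero hτ
  simp_all

/-! ### Theta functions as elements of `F` -/

theorem toF_congr {g g' : ℂ → ℂ → ℂ → ℂ → ℂ} {hg hg'}
    (h : ∀ α ζ ν τ, 0 < τ.im → g α ζ ν τ = g' α ζ ν τ) : toF g hg = toF g' hg' :=
  congrArg _ (Subtype.ext (funext fun p => h _ _ _ _ p.2))

theorem toF_mul (g g' : ℂ → ℂ → ℂ → ℂ → ℂ) (hg hg') :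
    toF g hg * toF g' hg' =
      toF (fun α ζ ν τ => g α ζ ν τ * g' α ζ ν τ) (DifferentiableOn.mul hg hg') :=
  (map_mul (algebraMap Hol F) _ _).symm

theorem toF_add (g g' : ℂ → ℂ → ℂ → ℂ → ℂ) (hg hg') :
    toF g hg + toF g' hg' =
      toF (fun α ζ ν τ => g α ζ ν τ + g' α ζ ν τ) (DifferentiableOn.add hg hg') :=
  (map_add (algebraMap Hol F) _ _).symm

theorem toF_sub (g g' : ℂ → ℂ → ℂ → ℂ → ℂ) (hg hg') :
    toF g hg - toF g' hg' =
      toF (fun α ζ ν τ => g α ζ ν τ - g' α ζ ν τ) (DifferentiableOn.sub hg hg') :=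
  (map_sub (algebraMap Hol F) _ _).symm

theorem toF_neg (g : ℂ → ℂ → ℂ → ℂ → ℂ) (hg) :
    -toF g hg = toF (fun α ζ ν τ => -g α ζ ν τ) (DifferentiableOn.neg hg) :=
  (map_neg (algebraMap Hol F) _).symm

/-- Holomorphic functions embed in their fraction field, so one nonzero value suffices. -/
theorem toF_ne_zero {g : ℂ → ℂ → ℂ → ℂ → ℂ} {hg} {α ζ ν τ : ℂ} (hτ : 0 < τ.im)
    (h : g α ζ ν τ ≠ 0) : toF g hg ≠ 0 := by
  rw [toF, Ne, IsFractionRing.to_map_eq_zero_iff]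
  intro h0
  exact h (congrArg (fun f : Hol => f.1 ⟨(α, ζ, ν, τ), hτ⟩) h0)

theorem substF_algebraMap {φ} (hφ hτ hinv) (f : Hol) :
    substF φ hφ hτ hinv (algebraMap Hol F f) = algebraMap Hol F (pull φ hφ hτ f) :=
  IsFractionRing.ringEquivOfRingEquiv_algebraMap _ _

theorem differentiableOn_bar {g : ℂ → ℂ → ℂ → ℂ → ℂ}
    (hg : DifferentiableOn ℂ (fun p : ℂ × ℂ × ℂ × ℂ => g p.1 p.2.1 p.2.2.1 p.2.2.2) cover) :
    DifferentiableOn ℂ (fun p : ℂ × ℂ × ℂ × ℂ => g p.1 p.2.1 (-p.2.2.1) p.2.2.2) cover :=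
  hg.comp (f := fun p : ℂ × ℂ × ℂ × ℂ => (p.1, p.2.1, -p.2.2.1, p.2.2.2)) (by fun_prop)
    fun _ hp => hp

theorem differentiableOn_swap {g : ℂ → ℂ → ℂ → ℂ → ℂ}
    (hg : DifferentiableOn ℂ (fun p : ℂ × ℂ × ℂ × ℂ => g p.1 p.2.1 p.2.2.1 p.2.2.2) cover) :
    DifferentiableOn ℂ (fun p : ℂ × ℂ × ℂ × ℂ => g p.2.1 p.1 p.2.2.1 p.2.2.2) cover :=
  hg.comp (f := fun p : ℂ × ℂ × ℂ × ℂ => (p.2.1, p.1, p.2.2.1, p.2.2.2)) (by fun_prop)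
    fun _ hp => hp

theorem bar_toF (g : ℂ → ℂ → ℂ → ℂ → ℂ) (hg) :
    bar (toF g hg) = toF (fun α ζ ν τ => g α ζ (-ν) τ) (differentiableOn_bar hg) :=
  substF_algebraMap _ _ _ _

theorem swap_toF (g : ℂ → ℂ → ℂ → ℂ → ℂ) (hg) :
    swap (toF g hg) = toF (fun α ζ ν τ => g ζ α ν τ) (differentiableOn_swap hg) :=
  substF_algebraMap _ _ _ _

/-- The linear form `iα + jζ + kν`. -/
def lin (x : ℤ × ℤ × ℤ) (α ζ ν : ℂ) : ℂ := x.1 * α + x.2.1 * ζ + x.2.2 * ν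

theorem lin_add (x y : ℤ × ℤ × ℤ) (α ζ ν : ℂ) :
    lin (x + y) α ζ ν = lin x α ζ ν + lin y α ζ ν := by
  simp only [lin, Prod.fst_add, Prod.snd_add]; push_cast; ring

theorem lin_sub (x y : ℤ × ℤ × ℤ) (α ζ ν : ℂ) :
    lin (x - y) α ζ ν = lin x α ζ ν - lin y α ζ ν := by
  simp only [lin, Prod.fst_sub, Prod.snd_sub]; push_cast; ring

theorem lin_neg (x : ℤ × ℤ × ℤ) (α ζ ν : ℂ) : lin (-x) α ζ ν = -lin x α ζ ν := by
  simp only [lin, Prod.fst_neg, Prod.snd_neg]; push_cast; ring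

theorem differentiable_lin (x : ℤ × ℤ × ℤ) :
    Differentiable ℂ fun p : ℂ × ℂ × ℂ × ℂ => lin x p.1 p.2.1 p.2.2.1 := by
  unfold lin; fun_prop

theorem differentiableOn_oddTheta (x : ℤ × ℤ × ℤ) : DifferentiableOn ℂ
    (fun p : ℂ × ℂ × ℂ × ℂ => oddTheta (lin x p.1 p.2.1 p.2.2.1) p.2.2.2) cover := by
  have h1 := differentiable_e
  have h2 := differentiable_lin x
  simp only [oddTheta_eq_jacobi]
  exact DifferentiableOn.mul (Differentiable.differentiableOn (by fun_prop))
    (differentiableOn_jacobi (by fun_prop) (by fun_prop) fun x hx => hx)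

theorem differentiableOn_degTwoTheta (f₁ f₂ : ParamFun) (x : ℤ × ℤ × ℤ) : DifferentiableOn ℂ
    (fun p : ℂ × ℂ × ℂ × ℂ => degTwoTheta (f₁ p.2.2.1 p.2.2.2) (f₂ p.2.2.1 p.2.2.2)
      (lin x p.1 p.2.1 p.2.2.1) p.2.2.2) cover := by
  have h1 := differentiable_e
  have h2 := differentiable_lin x
  simp only [degTwoTheta, thetaEven_eq, thetaOdd_eq]
  exact (f₁.differentiableOn.mul
    (differentiableOn_jacobi (by fun_prop) (by fun_prop) fun x hx => im_two_mul hx)).add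
    (f₂.differentiableOn.mul (DifferentiableOn.mul (Differentiable.differentiableOn (by fun_prop))
      (differentiableOn_jacobi (by fun_prop) (by fun_prop) fun x hx => im_two_mul hx)))

/-- `oddTheta` at the character `x`, as an element of `F`. -/
def oddF (x : ℤ × ℤ × ℤ) : F :=
  toF (fun α ζ ν τ => oddTheta (lin x α ζ ν) τ) (differentiableOn_oddTheta x)

/-- `f₁ thetaEven + f₂ thetaOdd` at the character `x`, as an element of `F`. -/
def degTwoF (f₁ f₂ : ParamFun) (x : ℤ × ℤ × ℤ) : F :=
  toF (fun α ζ ν τ => degTwoTheta (f₁ ν τ) (f₂ ν τ) (lin x α ζ ν) τ)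
    (differentiableOn_degTwoTheta f₁ f₂ x)

theorem oddF_neg (x : ℤ × ℤ × ℤ) : oddF (-x) = -oddF x := by
  simp only [oddF, toF_neg]
  refine toF_congr fun α ζ ν τ hτ => ?_
  rw [lin_neg, oddTheta_neg _ hτ]

theorem degTwoF_neg (f₁ f₂ : ParamFun) (x : ℤ × ℤ × ℤ) :
    degTwoF f₁ f₂ (-x) = degTwoF f₁ f₂ x := by
  refine toF_congr fun α ζ ν τ _ => ?_
  rw [lin_neg, degTwoTheta_neg]

theorem oddF_three_term (f₁ f₂ : ParamFun) (x y w : ℤ × ℤ × ℤ) :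
    oddF (x + w) * oddF (x - w) * degTwoF f₁ f₂ y - oddF (y + w) * oddF (y - w) * degTwoF f₁ f₂ x =
      oddF (x + y) * oddF (x - y) * degTwoF f₁ f₂ w := by
  simp only [oddF, degTwoF, toF_mul, toF_sub, lin_add, lin_sub]
  exact toF_congr fun α ζ ν τ hτ => oddTheta_three_term _ _ _ _ _ hτ

theorem oddF_four_term (x y w : ℤ × ℤ × ℤ) :
    oddF (y - x) * oddF (x + y + (x + y)) * oddF (x + w) * oddF (y + w) =
      oddF (x + y) * (oddF (x + x) * oddF (x + y + y + w) * oddF (y - w) -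
        oddF (x - w) * oddF (x + x + y + w) * oddF (y + y)) := by
  simp only [oddF, toF_mul, toF_sub, lin_add, lin_sub]
  exact toF_congr fun α ζ ν τ hτ => oddTheta_four_term _ _ _ hτ

theorem oddF_ne_zero {x : ℤ × ℤ × ℤ} (hx : x ≠ 0) : oddF x ≠ 0 := by
  have hI : 0 < I.im := by simp
  -- A nonzero linear form takes every value; 1/4 is one where `oddTheta` is known not to vanish.
  have h : ∃ α ζ ν : ℂ, lin x α ζ ν = 1 / 4 := by
    obtain ⟨i, j, k⟩ := x
    by_cases hi : i = 0
    · by_cases hj : j = 0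
      · have hk : (k : ℂ) ≠ 0 := by
          rintro hk
          exact hx (by simp [hi, hj, Int.cast_eq_zero.mp hk])
        exact ⟨0, 0, 1 / 4 / k, by simp only [lin]; field_simp; simp⟩
      · have hj' : (j : ℂ) ≠ 0 := Int.cast_ne_zero.mpr hj
        exact ⟨0, 1 / 4 / j, 0, by simp only [lin]; field_simp; simp⟩
    · have hi' : (i : ℂ) ≠ 0 := Int.cast_ne_zero.mpr hi
      exact ⟨1 / 4 / i, 0, 0, by simp only [lin]; field_simp; simp⟩
  obtain ⟨α, ζ, ν, h⟩ := h
  refine toF_ne_zero (α := α) (ζ := ζ) (ν := ν) hI ?_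
  rw [h]
  exact oddTheta_quarter_ne_zero hI

/-- `q^{1/8} (q; q)_∞`. -/
def etaF : F :=
  toF (fun _ _ _ τ => e (τ / 8) * eulerFun τ) (DifferentiableOn.mul
    (Differentiable.differentiableOn (by have := differentiable_e; fun_prop))
    differentiableOn_eulerFun)

theorem etaF_ne_zero : etaF ≠ 0 :=
  toF_ne_zero (α := 0) (ζ := 0) (ν := 0) (τ := I) (by simp)
    (mul_ne_zero (e_ne_zero _) (eulerFun_ne_zero (by simp)))

theorem differentiableOn_theta (i j k : ℤ) : DifferentiableOn ℂ
    (fun p : ℂ × ℂ × ℂ × ℂ => thetaFun (i * p.1 + j * p.2.1 + k * p.2.2.1) p.2.2.2) cover :=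
  fun p hp => ((differentiableAt_thetaFun _ _ hp).comp p
    (f := fun p : ℂ × ℂ × ℂ × ℂ => (i * p.1 + j * p.2.1 + k * p.2.2.1, p.2.2.2))
    (by fun_prop)).differentiableWithinAt

theorem etaF_mul_theta (i j k : ℤ) : etaF * theta i j k = oddF (i, j, k) := by
  have h : theta i j k = toF (fun α ζ ν τ => thetaFun (i * α + j * ζ + k * ν) τ)
    (differentiableOn_theta i j k) := rfl
  rw [h, etaF, oddF, toF_mul]
  exact toF_congr fun α ζ ν τ hτ => (oddTheta_eq _ hτ).symm

/-- Diagonal stable entries have degree two in ϑ, and so do the quotient entries, so the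
denominators combine to `etaF` squared, the factor split off from Υ in `Upsilon_eq`. -/
theorem theta_eq (i j k : ℤ) : theta i j k = oddF (i, j, k) / etaF := by
  rw [← etaF_mul_theta, mul_div_cancel_left₀ _ etaF_ne_zero]

theorem Upsilon_eq (f₀ f₁ f₂ : ParamFun) :
    Upsilon f₀ f₁ f₂ = etaF ^ 2 * (f₀.inF * degTwoF f₁ f₂ (0, 0, 1)) := by
  simp only [Upsilon, etaF, degTwoF, ParamFun.inF, pow_two, toF_mul]
  refine toF_congr fun α ζ ν τ _ => ?_
  have h : e (τ / 4) = e (τ / 8) * e (τ / 8) := by rw [← e_add]; congr 1; ring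
  have h2 : lin (0, 0, 1) α ζ ν = ν := by simp [lin]
  rw [upsilonFun, degTwoTheta, h, h2]
  ring

/-! ### Action of v ↦ v⁻¹ and a ↔ z on the building blocks. -/

theorem bar_inF {f : ParamFun} (h : f.BarInvariant) : bar f.inF = f.inF := by
  rw [ParamFun.inF, bar_toF]
  exact toF_congr fun α ζ ν τ hτ => h ν τ hτ

theorem swap_inF (f : ParamFun) : swap f.inF = f.inF := by
  rw [ParamFun.inF, swap_toF]

theorem bar_oddF (i j k : ℤ) : bar (oddF (i, j, k)) = oddF (i, j, -k) := by
  rw [oddF, bar_toF]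
  refine toF_congr fun α ζ ν τ _ => ?_
  simp [lin]

theorem swap_oddF (i j k : ℤ) : swap (oddF (i, j, k)) = oddF (j, i, k) := by
  rw [oddF, swap_toF]
  refine toF_congr fun α ζ ν τ _ => ?_
  simp [lin, add_comm]

theorem bar_degTwoF {f₁ f₂ : ParamFun} (h₁ : f₁.BarInvariant) (h₂ : f₂.BarInvariant) (i j k : ℤ) :
    bar (degTwoF f₁ f₂ (i, j, k)) = degTwoF f₁ f₂ (i, j, -k) := by
  rw [degTwoF, bar_toF]
  refine toF_congr fun α ζ ν τ hτ => ?_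
  simp [lin, h₁ ν τ hτ, h₂ ν τ hτ]

theorem swap_degTwoF (f₁ f₂ : ParamFun) (i j k : ℤ) :
    swap (degTwoF f₁ f₂ (i, j, k)) = degTwoF f₁ f₂ (j, i, k) := by
  rw [degTwoF, swap_toF]
  refine toF_congr fun α ζ ν τ _ => ?_
  simp [lin, add_comm]

theorem bar_Upsilon {f₀ f₁ f₂ : ParamFun} (h₀ : f₀.BarInvariant) (h₁ : f₁.BarInvariant)
    (h₂ : f₂.BarInvariant) : bar (Upsilon f₀ f₁ f₂) = Upsilon f₀ f₁ f₂ := by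
  have h : bar etaF = etaF := bar_toF _ _
  rw [Upsilon_eq, map_mul, map_pow, map_mul, h, bar_inF h₀, bar_degTwoF h₁ h₂,
    ← degTwoF_neg f₁ f₂ (0, 0, -1)]
  simp

/-! ### Nonvanishing of Υ, from its behaviour as q → 0. -/

instance : qToZero.NeBot :=
  Filter.NeBot.comap_of_range_mem atTop_neBot (by
    rw [Set.range_eq_univ.mpr Complex.im_surjective]; exact univ_mem)

theorem tendsto_e_half_qToZero : Tendsto (fun τ => e (τ / 2)) qToZero (𝓝 0) := by
  rw [tendsto_zero_iff_norm_tendsto_zero]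
  have h : ∀ τ : ℂ, ‖e (τ / 2)‖ = Real.exp (-(Real.pi * τ.im)) := fun τ => by
    rw [norm_e]; congr 1; simp; ring
  simp only [h]
  exact Real.tendsto_exp_neg_atTop_nhds_zero.comp
    (tendsto_comap.const_mul_atTop Real.pi_pos)

theorem ParamFun.eventually_ne_zero_of_lead {f : ParamFun} {c : ℝ} {ν : ℂ}
    (h : (fun τ => f.normalized c ν τ - 1) =O[qToZero] fun τ => e (τ / 2)) :
    ∀ᶠ τ in qToZero, f ν τ ≠ 0 := by
  have h1 := (h.trans_tendsto tendsto_e_half_qToZero).eventually_ne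
    (show (0 : ℂ) ≠ -1 by norm_num)
  filter_upwards [h1] with τ hτ h0
  exact hτ (by simp [normalized, h0])

/-- At v = i the series multiplying f₂ vanishes, leaving f₀f₁ times nonzero factors; f₀ and f₁ are
nonzero for small q by their leading terms. -/
theorem Upsilon_ne_zero {f₀ f₁ f₂ : ParamFun} {c₀ c₁ c₂ : ℝ}
    (hf : IsAdmissible f₀ f₁ f₂ c₀ c₁ c₂) : Upsilon f₀ f₁ f₂ ≠ 0 := by
  have hpos : ∀ᶠ τ in qToZero, 0 < τ.im := tendsto_comap.eventually (eventually_gt_atTop 0)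
  obtain ⟨τ, h0, h1, hτ⟩ := ((ParamFun.eventually_ne_zero_of_lead (hf.lead₀ (1 / 4))).and
    ((ParamFun.eventually_ne_zero_of_lead (hf.lead₁ (1 / 4))).and hpos)).exists
  rw [Upsilon_eq]
  refine mul_ne_zero (pow_ne_zero _ etaF_ne_zero) (mul_ne_zero ?_ ?_)
  · exact toF_ne_zero (α := 0) (ζ := 0) (ν := 1 / 4) hτ h0
  · refine toF_ne_zero (α := 0) (ζ := 0) (ν := 1 / 4) hτ ?_
    rw [show lin (0, 0, 1) 0 0 (1 / 4) = 1 / 4 by simp [lin], degTwoTheta, thetaOdd_quarter,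
      mul_zero, add_zero]
    exact mul_ne_zero h1 (thetaEven_quarter_ne_zero hτ)

/-! ### Products of canonical bases -/

/-- Inserting the values of 𝒪(n), the f₁-monomial becomes (vza^{-s})^{2l}(za^s)^{m+1/2} with s =
`p.sgn`, and the f₂-monomial has 2l+1 in place of 2l. The quadratic exponent of q is diagonal in l
and m, so both double sums factor, with the m-sum in common. -/
theorem canX_two (f₀ f₁ f₂ : ParamFun) (p : FixedPoint) :
    canX f₀ f₁ f₂ two p = oddF (p.sgn, 1, 0) * degTwoF f₁ f₂ (-p.sgn, 1, 1) := by
  simp only [canX, oddF, degTwoF, ParamFun.inF, toF_mul, toF_add]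
  refine toF_congr fun α ζ ν τ hτ => ?_
  have h1 : lin (p.sgn, 1, 0) α ζ ν = ζ + p.sgn * α := by simp [lin]; ring
  have h2 : lin (-p.sgn, 1, 1) α ζ ν = ζ + ν - p.sgn * α := by simp [lin]; ring
  have h3 : e (3 * τ / 8 + (ζ + ν - p.sgn * α) + (ζ + p.sgn * α) / 2) =
      e (τ / 8 + (ζ + p.sgn * α) / 2) * e (τ / 4 + (ζ + ν - p.sgn * α)) := by
    rw [← e_add]; congr 1; ring
  rw [series₁_eq _ _ _ _ hτ, series₂_eq _ _ _ _ hτ, h1, h2, h3, oddTheta_eq_jacobi, degTwoTheta,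
    thetaEven_eq, thetaOdd_eq]
  ring

/-- Here the monomial is (zv²a^{-s})^{m+1/2}, so the series is already an odd theta series. -/
theorem canX_oneOne (f₀ f₁ f₂ : ParamFun) (p : FixedPoint) :
    canX f₀ f₁ f₂ oneOne p = f₀.inF * oddF (-p.sgn, 1, 2) := by
  simp only [canX, oddF]
  congr 1
  refine toF_congr fun α ζ ν τ hτ => ?_
  have h1 : lin (-p.sgn, 1, 2) α ζ ν = ζ + (2 * ν - p.sgn * α) := by simp [lin]; ring
  rw [series₀_eq, h1, oddTheta_eq_jacobi]

theorem sgn_dual (p : FixedPoint) : p.dual.sgn = -p.sgn := by cases p <;> rfl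

theorem CanDual_two (f₀ f₁ f₂ : ParamFun) (p : FixedPoint) :
    CanDual f₀ f₁ f₂ p two = f₀.inF * oddF (1, p.sgn, 2) := by
  change swap (canX f₀ f₁ f₂ oneOne p.dual) = _
  rw [canX_oneOne, map_mul, swap_inF, swap_oddF, sgn_dual, neg_neg]

theorem CanDual_oneOne (f₀ f₁ f₂ : ParamFun) (p : FixedPoint) :
    CanDual f₀ f₁ f₂ p oneOne = oddF (1, -p.sgn, 0) * degTwoF f₁ f₂ (1, p.sgn, 1) := by
  change swap (canX f₀ f₁ f₂ two p.dual) = _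
  rw [canX_two, map_mul, swap_oddF, swap_degTwoF, sgn_dual, neg_neg]

theorem sum_fixedPoint {M : Type*} [AddCommMonoid M] (f : FixedPoint → M) :
    ∑ p, f p = f two + f oneOne := by
  rw [show (Finset.univ : Finset FixedPoint) = {two, oneOne} from rfl,
    Finset.sum_pair (by decide)]

/-- The matrix whose columns are the vectors `Stab^ell_X(p)`. -/
def StabX : Matrix FixedPoint FixedPoint F := Matrix.of fun p' p => stabX p p'

/-- The relations between theta functions at characters of a rank three torus: `S` is odd of
degree one and `G` even of degree two. -/
structure IsThetaPair {K : Type*} [Field K] (S G : ℤ × ℤ × ℤ → K) : Prop where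
  odd_neg : ∀ x, S (-x) = -S x
  even_neg : ∀ x, G (-x) = G x
  ne_zero : ∀ {x}, x ≠ 0 → S x ≠ 0
  three_term : ∀ x y w, S (x + w) * S (x - w) * G y - S (y + w) * S (y - w) * G x =
    S (x + y) * S (x - y) * G w
  four_term : ∀ x y w, S (y - x) * S (x + y + (x + y)) * S (x + w) * S (y + w) =
    S (x + y) * (S (x + x) * S (x + y + y + w) * S (y - w) -
      S (x - w) * S (x + x + y + w) * S (y + y))

/-! ### The eight entry identities, four for each matrix product. -/

theorem mul_div_mul_div_cancel_sq {K : Type*} [Field K] {η : K} (hη : η ≠ 0) (c x y : K) :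
    η ^ 2 * c * (x / η * (y / η)) = c * (x * y) := by
  field_simp

theorem mul_quotient_cancel_sq {K : Type*} [Field K] {η : K} (hη : η ≠ 0)
    (c a x₁ x₂ x₃ y₁ y₂ y₃ d₁ d₂ : K) :
    η ^ 2 * c * (a / η * (x₁ / η * (x₂ / η) * (x₃ / η) + y₁ / η * (y₂ / η) * (y₃ / η)) /
      (d₁ / η * (d₂ / η))) = c * (a * (x₁ * x₂ * x₃ + y₁ * y₂ * y₃)) / (d₁ * d₂) := by
  field_simp

namespace IsThetaPair

/-- The three-term relation at the two arguments of `G`, with third argument v; the other diagonal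
entries work the same way. -/
theorem product_two_two {K : Type*} [Field K] {S G : ℤ × ℤ × ℤ → K} (T : IsThetaPair S G) {η : K}
    (hη : η ≠ 0)
    (f : K) :
    S (1, 1, 0) * G (-1, 1, 1) * (f * S (1, 1, 2)) +
        f * S (-1, 1, 2) * (S (1, -1, 0) * G (1, 1, 1)) =
      η ^ 2 * (f * G (0, 0, 1)) *
        (S (-2, 0, 0) / η * (S (0, -2, -2) / η)) := by
  have h : S (1, 1, 2) * S (1, 1, 0) * G (-1, 1, 1) -
      S (-1, 1, 2) * S (-1, 1, 0) * G (1, 1, 1) =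
    S (0, 2, 2) * S (2, 0, 0) * G (0, 0, 1) :=
    T.three_term (1, 1, 1) (-1, 1, 1) (0, 0, 1)
  have n1 : S (1, -1, 0) = -S (-1, 1, 0) := by simpa using T.odd_neg (-1, 1, 0)
  have n2 : S (-2, 0, 0) = -S (2, 0, 0) := by simpa using T.odd_neg (2, 0, 0)
  have n3 : S (0, -2, -2) = -S (0, 2, 2) := by simpa using T.odd_neg (0, 2, 2)
  rw [mul_div_mul_div_cancel_sq hη, n1, n2, n3]
  linear_combination f * h

/-- The three-term relation evaluates the left side, up to f, G(v), S(v²) and sign, as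
S(az)S(z²a⁻²)/S(za⁻¹). The four-term relation rewrites this quotient with the denominator of the
stable entry. -/
theorem product_two_oneOne {K : Type*} [Field K] {S G : ℤ × ℤ × ℤ → K} (T : IsThetaPair S G) {η : K}
    (hη : η ≠ 0)
    (f : K) :
    S (1, 1, 0) * G (-1, 1, 1) * (f * S (1, -1, 2)) +
        f * S (-1, 1, 2) * (S (1, 1, 0) * G (1, -1, 1)) =
      η ^ 2 * (f * G (0, 0, 1)) *
        (S (0, 0, -2) / η *
        (S (-2, 0, 0) / η * (S (-1, 2, 1) / η) * (S (0, 1, -1) / η) +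
          S (-1, 0, -1) / η * (S (-2, 1, 1) / η) * (S (0, -2, 0) / η)) /
        (S (1, 0, -1) / η * (S (0, 1, 1) / η))) := by
  have h : S (-1, 1, 2) * S (-1, 1, 0) * G (-1, 1, -1) -
      S (-1, 1, 0) * S (-1, 1, -2) * G (-1, 1, 1) =
    S (-2, 2, 0) * S (0, 0, 2) * G (0, 0, 1) :=
    T.three_term (-1, 1, 1) (-1, 1, -1) (0, 0, 1)
  have h4 : S (1, 1, 0) * S (-2, 2, 0) * S (-1, 0, 1) * S (0, 1, 1) =
      S (-1, 1, 0) *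
        (S (-2, 0, 0) * S (-1, 2, 1) * S (0, 1, -1) -
          S (-1, 0, -1) * S (-2, 1, 1) * S (0, 2, 0)) := by
    simpa only [Prod.mk_add_mk, Prod.mk_sub_mk, Int.reduceNeg, Int.reduceAdd, Int.reduceSub]
      using T.four_term (-1, 0, 0) (0, 1, 0) (0, 0, 1)
  have n1 : S (1, -1, 2) = -S (-1, 1, -2) := by simpa using T.odd_neg (-1, 1, -2)
  have n2 : S (0, 0, -2) = -S (0, 0, 2) := by simpa using T.odd_neg (0, 0, 2)
  have n3 : S (0, -2, 0) = -S (0, 2, 0) := by simpa using T.odd_neg (0, 2, 0)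
  have n4 : S (1, 0, -1) = -S (-1, 0, 1) := by simpa using T.odd_neg (-1, 0, 1)
  have g1 : G (1, -1, 1) = G (-1, 1, -1) := by
    simpa using T.even_neg (-1, 1, -1)
  have d1 := T.ne_zero (x := (-1, 1, 0)) (by decide)
  have d2 := T.ne_zero (x := (-1, 0, 1)) (by decide)
  have d3 := T.ne_zero (x := (0, 1, 1)) (by decide)
  rw [mul_quotient_cancel_sq hη, n1, n2, n3, n4, g1, eq_div_iff (by simp [d2, d3])]
  -- Both relations carry the factor S(za⁻¹), absent from the goal, so it is introduced before
  -- combining them.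
  refine mul_left_cancel₀ d1 ?_
  linear_combination (-(S (-1, 0, 1) * S (0, 1, 1) * f * S (1, 1, 0))) * h -
  f * G (0, 0, 1) * S (0, 0, 2) * h4

/-- The two summands are negatives of each other by oddness of `S`: this is the triangularity of the
stable basis. -/
theorem product_oneOne_two {K : Type*} [Field K] {S G : ℤ × ℤ × ℤ → K} (T : IsThetaPair S G)
    (f : K) :
    S (-1, 1, 0) * G (1, 1, 1) * (f * S (1, 1, 2)) +
        f * S (1, 1, 2) * (S (1, -1, 0) * G (1, 1, 1)) =
      0 := by
  have n1 : S (1, -1, 0) = -S (-1, 1, 0) := by simpa using T.odd_neg (-1, 1, 0)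
  rw [n1]
  ring

theorem product_oneOne_oneOne {K : Type*} [Field K] {S G : ℤ × ℤ × ℤ → K} (T : IsThetaPair S G) {η : K}
    (hη : η ≠ 0)
    (f : K) :
    S (-1, 1, 0) * G (1, 1, 1) * (f * S (1, -1, 2)) +
        f * S (1, 1, 2) * (S (1, 1, 0) * G (1, -1, 1)) =
      η ^ 2 * (f * G (0, 0, 1)) *
        (S (-2, 0, -2) / η * (S (0, -2, 0) / η)) := by
  have h : S (1, 1, 2) * S (1, 1, 0) * G (1, -1, 1) -
      S (1, -1, 2) * S (1, -1, 0) * G (1, 1, 1) =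
    S (2, 0, 2) * S (0, 2, 0) * G (0, 0, 1) :=
    T.three_term (1, 1, 1) (1, -1, 1) (0, 0, 1)
  have n1 : S (-1, 1, 0) = -S (1, -1, 0) := by simpa using T.odd_neg (1, -1, 0)
  have n2 : S (-2, 0, -2) = -S (2, 0, 2) := by simpa using T.odd_neg (2, 0, 2)
  have n3 : S (0, -2, 0) = -S (0, 2, 0) := by simpa using T.odd_neg (0, 2, 0)
  rw [mul_div_mul_div_cancel_sq hη, n1, n2, n3]
  linear_combination f * h

theorem flop_product_two_two {K : Type*} [Field K] {S G : ℤ × ℤ × ℤ → K} (T : IsThetaPair S G) {η : K}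
    (hη : η ≠ 0)
    (f : K) :
    S (1, 1, 0) * G (-1, 1, 1) * (f * S (1, 1, -2)) +
        f * S (-1, 1, 2) * (S (1, -1, 0) * G (1, 1, -1)) =
      -(η ^ 2 * (f * G (0, 0, 1)) *
        (S (2, 0, -2) / η * (S (0, -2, 0) / η))) := by
  have h : S (1, 1, 0) * S (1, 1, -2) * G (-1, 1, 1) -
      S (-1, 1, 2) * S (-1, 1, 0) * G (1, 1, -1) =
    S (0, 2, 0) * S (2, 0, -2) * G (0, 0, 1) :=
    T.three_term (1, 1, -1) (-1, 1, 1) (0, 0, 1)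
  have n1 : S (1, -1, 0) = -S (-1, 1, 0) := by simpa using T.odd_neg (-1, 1, 0)
  have n2 : S (0, -2, 0) = -S (0, 2, 0) := by simpa using T.odd_neg (0, 2, 0)
  rw [mul_div_mul_div_cancel_sq hη, n1, n2]
  linear_combination f * h

theorem flop_product_two_oneOne {K : Type*} [Field K] {S G : ℤ × ℤ × ℤ → K} (T : IsThetaPair S G)
    (f : K) :
    S (1, 1, 0) * G (-1, 1, 1) * (f * S (1, -1, -2)) +
        f * S (-1, 1, 2) * (S (1, 1, 0) * G (1, -1, -1)) =
      0 := by
  have n1 : S (1, -1, -2) = -S (-1, 1, 2) := by simpa using T.odd_neg (-1, 1, 2)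
  have g1 : G (1, -1, -1) = G (-1, 1, 1) := by
    simpa using T.even_neg (-1, 1, 1)
  rw [n1, g1]
  ring

/-- The counterpart of `product_two_oneOne` for the opposite chamber, now with auxiliary factor
S(az). -/
theorem flop_product_oneOne_two {K : Type*} [Field K] {S G : ℤ × ℤ × ℤ → K} (T : IsThetaPair S G) {η : K}
    (hη : η ≠ 0)
    (f : K) :
    S (-1, 1, 0) * G (1, 1, 1) * (f * S (1, 1, -2)) +
        f * S (1, 1, 2) * (S (1, -1, 0) * G (1, 1, -1)) =
      -(η ^ 2 * (f * G (0, 0, 1)) *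
        (S (0, 0, -2) / η *
        (S (2, 0, 0) / η * (S (1, 2, 1) / η) * (S (0, 1, -1) / η) +
          S (1, 0, -1) / η * (S (2, 1, 1) / η) * (S (0, -2, 0) / η)) /
        (S (-1, 0, -1) / η * (S (0, 1, 1) / η)))) := by
  have h : S (1, 1, 2) * S (1, 1, 0) * G (1, 1, -1) -
      S (1, 1, 0) * S (1, 1, -2) * G (1, 1, 1) =
    S (2, 2, 0) * S (0, 0, 2) * G (0, 0, 1) :=
    T.three_term (1, 1, 1) (1, 1, -1) (0, 0, 1)
  have h4 : S (-1, 1, 0) * S (2, 2, 0) * S (1, 0, 1) * S (0, 1, 1) =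
      S (1, 1, 0) *
        (S (2, 0, 0) * S (1, 2, 1) * S (0, 1, -1) -
          S (1, 0, -1) * S (2, 1, 1) * S (0, 2, 0)) :=
    T.four_term (1, 0, 0) (0, 1, 0) (0, 0, 1)
  have n1 : S (1, -1, 0) = -S (-1, 1, 0) := by simpa using T.odd_neg (-1, 1, 0)
  have n2 : S (0, 0, -2) = -S (0, 0, 2) := by simpa using T.odd_neg (0, 0, 2)
  have n3 : S (0, -2, 0) = -S (0, 2, 0) := by simpa using T.odd_neg (0, 2, 0)
  have n4 : S (-1, 0, -1) = -S (1, 0, 1) := by simpa using T.odd_neg (1, 0, 1)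
  have d1 := T.ne_zero (x := (1, 1, 0)) (by decide)
  have d2 := T.ne_zero (x := (1, 0, 1)) (by decide)
  have d3 := T.ne_zero (x := (0, 1, 1)) (by decide)
  rw [mul_quotient_cancel_sq hη, n1, n2, n3, n4, ← neg_div, eq_div_iff (by simp [d2, d3])]
  refine mul_left_cancel₀ d1 ?_
  linear_combination (S (1, 0, 1) * S (0, 1, 1) * f * S (-1, 1, 0)) * h +
  f * G (0, 0, 1) * S (0, 0, 2) * h4

theorem flop_product_oneOne_oneOne {K : Type*} [Field K] {S G : ℤ × ℤ × ℤ → K} (T : IsThetaPair S G) {η : K}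
    (hη : η ≠ 0)
    (f : K) :
    S (-1, 1, 0) * G (1, 1, 1) * (f * S (1, -1, -2)) +
        f * S (1, 1, 2) * (S (1, 1, 0) * G (1, -1, -1)) =
      -(η ^ 2 * (f * G (0, 0, 1)) *
        (S (2, 0, 0) / η * (S (0, -2, -2) / η))) := by
  have h : S (1, 1, 2) * S (1, 1, 0) * G (1, -1, -1) -
      S (1, -1, 0) * S (1, -1, -2) * G (1, 1, 1) =
    S (2, 0, 0) * S (0, 2, 2) * G (0, 0, 1) :=
    T.three_term (1, 1, 1) (1, -1, -1) (0, 0, 1)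
  have n1 : S (-1, 1, 0) = -S (1, -1, 0) := by simpa using T.odd_neg (1, -1, 0)
  have n2 : S (0, -2, -2) = -S (0, 2, 2) := by simpa using T.odd_neg (0, 2, 2)
  rw [mul_div_mul_div_cancel_sq hη, n1, n2]
  linear_combination f * h

end IsThetaPair

/-! ### The two matrix factorizations over `F`. -/

theorem isThetaPair (f₁ f₂ : ParamFun) : IsThetaPair oddF (degTwoF f₁ f₂) where
  odd_neg := oddF_neg
  even_neg := degTwoF_neg f₁ f₂
  ne_zero := oddF_ne_zero
  three_term := oddF_three_term f₁ f₂
  four_term := oddF_four_term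

theorem isUnit_of_upperTriangular {K : Type*} [Field K] {A : Matrix FixedPoint FixedPoint K}
    (h0 : A oneOne two = 0) (h1 : A two two ≠ 0) (h2 : A oneOne oneOne ≠ 0) : IsUnit A := by
  have h : A * (Matrix.of fun p' p => match p', p with
      | two, two => (A two two)⁻¹
      | two, oneOne => -(A two oneOne / (A two two * A oneOne oneOne))
      | oneOne, two => 0
      | oneOne, oneOne => (A oneOne oneOne)⁻¹) = 1 := by
    ext p' p
    cases p' <;> cases p <;> simp [Matrix.mul_apply, sum_fixedPoint, h0, h1, h2]
    field_simp
    ring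
  exact IsUnit.of_mul_eq_one _ h

/-- The companion of the flopped factorization; comparing the two is what makes the canonical basis
bar-invariant. -/
theorem canX_mul_canDual (f₀ f₁ f₂ : ParamFun) :
    CanX f₀ f₁ f₂ * (CanDual f₀ f₁ f₂)ᵀ = Upsilon f₀ f₁ f₂ • StabX := by
  ext p p'
  simp only [Matrix.mul_apply, sum_fixedPoint, Matrix.transpose_apply, CanDual_two,
    CanDual_oneOne, CanX, StabX, Matrix.of_apply, canX_two, canX_oneOne, Matrix.smul_apply,
    smul_eq_mul, Upsilon_eq]
  cases p <;> cases p' <;> simp only [stabX, sgn, theta_eq, neg_neg, mul_zero]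
  · exact (isThetaPair f₁ f₂).product_two_two etaF_ne_zero _
  · exact (isThetaPair f₁ f₂).product_two_oneOne etaF_ne_zero _
  · exact (isThetaPair f₁ f₂).product_oneOne_two _
  · exact (isThetaPair f₁ f₂).product_oneOne_oneOne etaF_ne_zero _

theorem canX_mul_canDualFlop {f₀ f₁ f₂ : ParamFun} (h₀ : f₀.BarInvariant) (h₁ : f₁.BarInvariant)
    (h₂ : f₂.BarInvariant) :
    CanX f₀ f₁ f₂ * (CanDualFlop f₀ f₁ f₂)ᵀ = -(Upsilon f₀ f₁ f₂ • StabNegX) := by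
  ext p p'
  simp only [Matrix.mul_apply, sum_fixedPoint, Matrix.transpose_apply, CanDual_two, CanDualFlop,
    Matrix.map_apply, map_mul, bar_inF h₀, bar_oddF, bar_degTwoF h₁ h₂,
    CanDual_oneOne, CanX, StabNegX, Matrix.of_apply, canX_two, canX_oneOne, Matrix.smul_apply,
    smul_eq_mul, Upsilon_eq, Matrix.neg_apply]
  cases p <;> cases p' <;> simp only [stabNegX, sgn, theta_eq, neg_neg, mul_zero, neg_zero]
  · exact (isThetaPair f₁ f₂).flop_product_two_two etaF_ne_zero _
  · exact (isThetaPair f₁ f₂).flop_product_two_oneOne _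
  · exact (isThetaPair f₁ f₂).flop_product_oneOne_two etaF_ne_zero _
  · exact (isThetaPair f₁ f₂).flop_product_oneOne_oneOne etaF_ne_zero _

/-! ### The elliptic bar involution -/

theorem isUnit_StabX : IsUnit StabX := by
  have h : ∀ i j k i' j' k', (i, j, k) ≠ (0 : ℤ × ℤ × ℤ) → (i', j', k') ≠ (0 : ℤ × ℤ × ℤ) →
      theta i j k * theta i' j' k' ≠ 0 := fun i j k i' j' k' hx hy => by
    rw [theta_eq, theta_eq]
    exact mul_ne_zero (div_ne_zero (oddF_ne_zero hx) etaF_ne_zero)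
      (div_ne_zero (oddF_ne_zero hy) etaF_ne_zero)
  exact isUnit_of_upperTriangular rfl (h _ _ _ _ _ _ (by decide) (by decide))
    (h _ _ _ _ _ _ (by decide) (by decide))

/-- The semilinear map sending the columns of the invertible matrix `A` to those of `B`. -/
def barExtend (A B : Matrix FixedPoint FixedPoint F) : Loc →ₛₗ[(bar : F →+* F)] Loc where
  toFun x := B *ᵥ (bar ∘ (A⁻¹ *ᵥ x))
  map_add' x y := by
    have h : bar ∘ (A⁻¹ *ᵥ (x + y)) = bar ∘ (A⁻¹ *ᵥ x) + bar ∘ (A⁻¹ *ᵥ y) := by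
      rw [Matrix.mulVec_add]
      exact funext fun p => bar.map_add _ _
    rw [h, Matrix.mulVec_add]
  map_smul' c x := by
    have h : bar ∘ (A⁻¹ *ᵥ (c • x)) = bar c • (bar ∘ (A⁻¹ *ᵥ x)) := by
      rw [Matrix.mulVec_smul]
      exact funext fun p => bar.map_mul _ _
    rw [h, Matrix.mulVec_smul]
    rfl

theorem barExtend_col {A : Matrix FixedPoint FixedPoint F} (hA : IsUnit A)
    (B : Matrix FixedPoint FixedPoint F) (p : FixedPoint) : barExtend A B (A.col p) = B.col p := by
  have h : A⁻¹ *ᵥ A.col p = Pi.single p 1 := by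
    rw [← Matrix.mulVec_single_one, Matrix.mulVec_mulVec,
      Matrix.nonsing_inv_mul _ ((Matrix.isUnit_iff_isUnit_det A).mp hA), Matrix.one_mulVec]
  have h2 : bar ∘ (Pi.single p 1 : Loc) = Pi.single p 1 := by
    ext r
    rcases eq_or_ne r p with rfl | hr <;> simp [*]
  change B *ᵥ (bar ∘ (A⁻¹ *ᵥ A.col p)) = _
  rw [h, h2, Matrix.mulVec_single_one]

theorem eq_barExtend {A : Matrix FixedPoint FixedPoint F} (hA : IsUnit A)
    {B : Matrix FixedPoint FixedPoint F} {β : Loc →ₛₗ[(bar : F →+* F)] Loc}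
    (hβ : ∀ p, β (A.col p) = B.col p) : β = barExtend A B := by
  ext1 x
  have hx : x = ∑ p, (A⁻¹ *ᵥ x) p • A.col p := by
    have : A *ᵥ (A⁻¹ *ᵥ x) = x := by
      rw [Matrix.mulVec_mulVec,
        Matrix.mul_nonsing_inv _ ((Matrix.isUnit_iff_isUnit_det A).mp hA), Matrix.one_mulVec]
    conv_lhs => rw [← this]
    ext p
    simp [Matrix.mulVec, dotProduct, mul_comm]
  rw [hx, map_sum, map_sum]
  refine Finset.sum_congr rfl fun p _ => ?_
  rw [LinearMap.map_smulₛₗ, LinearMap.map_smulₛₗ, hβ, barExtend_col hA]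

theorem isEllipticBarInvolution_iff (β : Loc →ₛₗ[(bar : F →+* F)] Loc) :
    IsEllipticBarInvolution β ↔ ∀ p, β (StabX.col p) = (-StabNegX).col p := by
  refine forall_congr' fun p => ?_
  have h : (-1 : F) ^ (dimX / 2) • stabNegX p = (-StabNegX).col p := by
    ext r
    simp [dimX, StabNegX]
  rw [h]
  rfl

theorem existsUnique_ellipticBarInvolution : ∃! β, IsEllipticBarInvolution β :=
  ⟨barExtend StabX (-StabNegX),
    (isEllipticBarInvolution_iff _).mpr (barExtend_col isUnit_StabX _),
    fun _ hβ => eq_barExtend isUnit_StabX ((isEllipticBarInvolution_iff _).mp hβ)⟩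

/-- If `c A = M K` and `c B = M K̄` for a nonzero bar-invariant scalar `c`, then the semilinear
map sending the columns of `A` to those of `B` fixes the columns of `M`. -/
theorem barExtend_fixes {A B M K : Matrix FixedPoint FixedPoint F} {c : F} (hA : IsUnit A)
    (hc : c ≠ 0) (hbar : bar c = c) (h1 : M * K = c • A) (h2 : M * K.map bar = c • B)
    (μ : FixedPoint) : barExtend A B (M.col μ) = M.col μ := by
  have hdet := (Matrix.isUnit_iff_isUnit_det A).mp hA
  have h3 : (A⁻¹ * M) * K = c • 1 := by
    rw [Matrix.mul_assoc, h1, Matrix.mul_smul, Matrix.nonsing_inv_mul _ hdet]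
  have h4 : (c⁻¹ • (A⁻¹ * M).map bar) * K.map bar = 1 := by
    have h := congrArg (fun X => X.map bar) h3
    rw [Matrix.map_mul] at h
    rw [Matrix.smul_mul, h]
    ext p r
    rcases eq_or_ne p r with rfl | hr <;> simp [*]
  -- For square matrices a left inverse is a right inverse, so multiplying by M on the left brings
  -- in `h2`.
  have h5 := mul_eq_one_comm.mp h4
  have h6 : B * (A⁻¹ * M).map bar = M := by
    have h := congrArg (M * ·) h5
    simp only [← Matrix.mul_assoc, h2, Matrix.mul_one] at h
    rwa [Matrix.smul_mul, Matrix.mul_smul, smul_smul, mul_inv_cancel₀ hc, one_smul] at h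
  conv_rhs => rw [← h6]
  change B *ᵥ (bar ∘ (A⁻¹ *ᵥ M.col μ)) = _
  rw [← Matrix.mulVec_single_one M, Matrix.mulVec_mulVec, Matrix.mulVec_single_one,
    ← Matrix.mulVec_single_one (B * _), ← Matrix.mulVec_mulVec, Matrix.mulVec_single_one]
  rfl

end EllHilb

end

theorem mainTheorem2 (f₀ f₁ f₂ : EllHilb.ParamFun) (c₀ c₁ c₂ : ℝ)
    (hf : EllHilb.IsAdmissible f₀ f₁ f₂ c₀ c₁ c₂)
    (h₀ : f₀.BarInvariant) (h₁ : f₁.BarInvariant) (h₂ : f₂.BarInvariant) :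
    -(EllHilb.Upsilon f₀ f₁ f₂ • EllHilb.StabNegX) =
        EllHilb.CanNegX f₀ f₁ f₂ * (EllHilb.CanDualFlop f₀ f₁ f₂)ᵀ ∧
      (∃! β, EllHilb.IsEllipticBarInvolution β) ∧
      ∀ β, EllHilb.IsEllipticBarInvolution β →
        ∀ μ : EllHilb.FixedPoint, β (EllHilb.canX f₀ f₁ f₂ μ) = EllHilb.canX f₀ f₁ f₂ μ := by
  have h := EllHilb.canX_mul_canDualFlop h₀ h₁ h₂
  refine ⟨h.symm, EllHilb.existsUnique_ellipticBarInvolution, fun β hβ μ => ?_⟩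
  rw [EllHilb.eq_barExtend EllHilb.isUnit_StabX ((EllHilb.isEllipticBarInvolution_iff β).mp hβ)]
  -- The sign goes into the target matrix, since β sends the columns of Stab_X to those of
  -- -Stab_{-X}.
  rw [← smul_neg] at h
  exact EllHilb.barExtend_fixes EllHilb.isUnit_StabX (EllHilb.Upsilon_ne_zero hf)
    (EllHilb.bar_Upsilon h₀ h₁ h₂) (EllHilb.canX_mul_canDual f₀ f₁ f₂) h μ
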